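/- **Corollary (recurrence).** For integers $d, s \ge 0$ let $\mathcal{E}_d^{(s)} \subset \mathbb{R}^d$ be the set of all $(a_1,\dots,a_d)$ such that all complex roots of $x^d + a_1 x^{d-1} + \dots + a_d$ have absolute value less than $1$ and exactly $s$ pairs of these roots are complex conjugate (nonreal), counted with multiplicity. Let $v_d^{(s)}$ be the $d$-dimensional Lebesgue measure of $\mathcal{E}_d^{(s)}$ (with $\mathbb{R}^0$ a single point of measure $1$). Then, for all $d \ge 0$, $0 < v_d^{(0)} < \infty$ and $v_d^{(1)} < \infty$, so that the ratios $q_d = v_d^{(1)}/v_d^{(0)}$ are well-defined real numbers, and they satisfy $$d\,q_d - 3(2d-1)\,q_{d-1} + (d-1)\,q_{d-2} = 2d(d-1) \qquad (d \ge 2), \qquad q_0 = q_1 = 0.$$ -/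

import Mathlib

namespace ContractivePoly

open Polynomial MeasureTheory
open scoped ENNReal

/-- The monic real polynomial `x ^ d + a₁ x ^ (d - 1) + ⋯ + a_d`; the entry `a i` of the
0-indexed vector `a : Fin d → ℝ` is the coefficient `a_{i+1}`. -/
noncomputable def poly {d : ℕ} (a : Fin d → ℝ) : ℝ[X] :=
  X ^ d + ∑ i : Fin d, C (a i) * X ^ (d - 1 - (i : ℕ))

/-- Coefficient vectors of the contractive polynomials of degree `d`: all complex roots have
absolute value less than 1. -/
def region (d : ℕ) : Set (Fin d → ℝ) :=
  {a | ∀ z ∈ (poly a).aroots ℂ, ‖z‖ < 1}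

/-- Coefficient vectors of the contractive polynomials of degree `d` with exactly `s` pairs of
complex conjugate (nonreal) roots, that is with exactly `2 * s` nonreal roots, counted with
multiplicity. -/
def regionPairs (d s : ℕ) : Set (Fin d → ℝ) :=
  {a | a ∈ region d ∧ (((poly a).aroots ℂ).filter (fun z : ℂ => z.im ≠ 0)).card = 2 * s}

/-- The `d`-dimensional Lebesgue measure of `regionPairs d s`. -/
noncomputable def vol (d s : ℕ) : ℝ≥0∞ := volume (regionPairs d s)

/-- The ratio of the measures for one and for zero pairs of complex conjugate roots. -/
noncomputable def ratio (d : ℕ) : ℝ := (vol d 1).toReal / (vol d 0).toReal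

end ContractivePoly

namespace ContractivePoly

open Polynomial MeasureTheory
open scoped ENNReal

/-! ### Legendre polynomials -/

/-! With `P_n` the Legendre polynomials, the ratio has the closed form `q_d = (P_d(3) - 2d - 1) / 4`
(`ratio_eq`). The claim is then the three-term recurrence of `P_d` at `3`; the affine part produces
the right-hand side.

Passing from coefficients to roots has Jacobian the modulus of the Vandermonde product, up to a
constant factor `2` when there is a conjugate pair (`abs_det_fderiv_rootCoeff`). So both volumes are
integrals of Vandermonde products, over ordered real tuples and, for one pair, over `z = x + iy` in
the upper half-disc as well. Up to a common constant such a product is the determinant with rows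
`(fleg 0, ..., fleg (d - 1))` evaluated at the roots.

Integrating an alternating form along this curve against the sign of the Vandermonde product is a
Pfaffian-type integral (`pf`). The Legendre basis makes it computable: integrating `sgn (t - a)`
against `fleg (n + 1)` gives `P_n(a) - P_{n+2}(a)`, and by orthogonality this sees only one
coordinate of the curve. The resulting two-step recursion `pf_add_two` evaluates the integral when
no argument is left free (`pf_self`, for the real-rooted volume) and when two are
(`pf_curryLeft_comb_comb`, for one pair). In the quotient all constants cancel, and `q_d` is the
integral of `4 * altPair` over the half-disc.

The summands of `altPair` are Wronskian expressions in the real and imaginary parts of `P_n(z)` and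
`P_n'(z)`, that is, multiples of the `y`-derivative of `|P_n(x + iy)|²`. The `y`-integral leaves
boundary values on the real axis, where the norm of `P_n` enters, and on the unit circle. On the
circle `z * conj z = 1`, and an addition formula (`addPoly_eq`) expands `|P_n(z)|²` in powers of `1
- x²`. Integrated over `x`, it becomes the odd Taylor expansion of `P_{n+1} - P_{n-1}` about `1`
with increment `2`, which is how the argument `3` arises (`circInt_eq`). The sum over `n` telescopes
(`exists_integral_altPair`). -/

/-- The Legendre polynomials, defined by their three-term recurrence. -/
noncomputable def leg : ℕ → ℝ[X]
  | 0 => 1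
  | 1 => X
  | n + 2 => C ((2 * n + 3) / (n + 2) : ℝ) * X * leg (n + 1) - C ((n + 1) / (n + 2) : ℝ) * leg n

theorem leg_zero : leg 0 = 1 := by simp [leg]

theorem leg_one : leg 1 = X := by simp [leg]

theorem leg_rec (n : ℕ) :
    C (n + 2 : ℝ) * leg (n + 2) = C (2 * n + 3 : ℝ) * X * leg (n + 1) - C (n + 1 : ℝ) * leg n := by
  have h : (n + 2 : ℝ) ≠ 0 := by positivity
  rw [leg, mul_sub, ← mul_assoc, ← mul_assoc, ← mul_assoc, ← C_mul, ← C_mul,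
    mul_div_cancel₀ _ h, mul_div_cancel₀ _ h]

/-- The two identities are proved together because each induction step needs both: the
differentiated recurrence and the second give the first one index higher, and that in turn gives the
second. -/
theorem derivative_leg_aux (n : ℕ) :
    derivative (leg (n + 1)) = X * derivative (leg n) + C (n + 1 : ℝ) * leg n ∧
    X * derivative (leg (n + 1)) = derivative (leg n) + C (n + 1 : ℝ) * leg (n + 1) := by
  induction n with
  | zero => simp [leg_zero, leg_one]
  | succ n ih =>
    obtain ⟨ha, hb⟩ := ih
    have hr := leg_rec n
    have hd := congrArg derivative hr
    simp only [derivative_mul, derivative_sub, derivative_C, derivative_X, zero_mul, zero_add,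
      mul_one] at hd
    have hc : (C (n + 2 : ℝ)) ≠ 0 := by
      rw [Ne, C_eq_zero]; positivity
    have h1 : derivative (leg (n + 2)) =
        X * derivative (leg (n + 1)) + C (n + 2 : ℝ) * leg (n + 1) := by
      apply mul_left_cancel₀ hc
      simp only [C_add, C_mul] at *
      simp only [map_ofNat, map_natCast, map_one] at *
      linear_combination hd + (n + 1) * hb
    have e : ((n + 1 : ℕ) + 1 : ℝ) = n + 2 := by push_cast; ring
    rw [e]
    refine ⟨h1, ?_⟩
    rw [h1]
    simp only [C_add, C_mul] at *
    simp only [map_ofNat, map_natCast, map_one] at *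
    linear_combination X * hb - ha - hr

theorem derivative_leg_succ (n : ℕ) :
    derivative (leg (n + 1)) = X * derivative (leg n) + C (n + 1 : ℝ) * leg n :=
  (derivative_leg_aux n).1

theorem X_mul_derivative_leg_succ (n : ℕ) :
    X * derivative (leg (n + 1)) = derivative (leg n) + C (n + 1 : ℝ) * leg (n + 1) :=
  (derivative_leg_aux n).2

theorem derivative_leg_add_two (n : ℕ) :
    derivative (leg (n + 2)) - derivative (leg n) = C (2 * n + 3 : ℝ) * leg (n + 1) := by
  have h1 := derivative_leg_succ (n + 1)
  have h2 := X_mul_derivative_leg_succ n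
  rw [h1]
  push_cast
  simp only [C_add, C_mul] at *
  simp only [map_ofNat, map_natCast, map_one] at *
  linear_combination h2

theorem sq_sub_one_mul_derivative_leg (n : ℕ) :
    (X ^ 2 - 1) * derivative (leg (n + 1)) = C (n + 1 : ℝ) * (X * leg (n + 1) - leg n) := by
  linear_combination X * X_mul_derivative_leg_succ n - derivative_leg_succ n

/-- Legendre's differential equation. -/
theorem legendre_ode (n : ℕ) :
    derivative ((X ^ 2 - 1) * derivative (leg n)) = C (n * (n + 1) : ℝ) * leg n := by
  cases n with
  | zero => simp [leg_zero]
  | succ n =>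
    rw [sq_sub_one_mul_derivative_leg]
    simp only [derivative_mul, derivative_sub, derivative_C, derivative_X, zero_mul, zero_add,
      one_mul]
    have h2 := X_mul_derivative_leg_succ n
    push_cast
    simp only [C_add, C_mul] at *
    simp only [map_natCast, map_one] at *
    linear_combination (n + 1) * h2

theorem eval_one_leg (n : ℕ) : (leg n).eval 1 = 1 := by
  have h : (leg n).eval 1 = 1 ∧ (leg (n + 1)).eval 1 = 1 := by
    induction n with
    | zero => simp [leg_zero, leg_one]
    | succ n ih =>
      refine ⟨ih.2, ?_⟩
      have := congrArg (eval 1) (leg_rec n)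
      simp only [eval_mul, eval_sub, eval_C, eval_X, ih.1, ih.2] at this
      have h : (n + 2 : ℝ) ≠ 0 := by positivity
      apply mul_left_cancel₀ h
      linear_combination this
  exact h.1

theorem eval_neg_one_leg (n : ℕ) : (leg n).eval (-1) = (-1) ^ n := by
  have h : (leg n).eval (-1) = (-1) ^ n ∧ (leg (n + 1)).eval (-1) = (-1) ^ (n + 1) := by
    induction n with
    | zero => simp [leg_zero, leg_one]
    | succ n ih =>
      refine ⟨ih.2, ?_⟩
      have := congrArg (eval (-1)) (leg_rec n)
      simp only [eval_mul, eval_sub, eval_C, eval_X, ih.1, ih.2] at this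
      have h : (n + 2 : ℝ) ≠ 0 := by positivity
      apply mul_left_cancel₀ h
      rw [this]
      ring
  exact h.1

theorem degree_leg_aux (n : ℕ) : (leg n).natDegree ≤ n ∧ 0 < (leg n).coeff n := by
  have h : ((leg n).natDegree ≤ n ∧ 0 < (leg n).coeff n) ∧
      ((leg (n + 1)).natDegree ≤ n + 1 ∧ 0 < (leg (n + 1)).coeff (n + 1)) := by
    induction n with
    | zero => simp [leg_zero, leg_one]
    | succ n ih =>
      obtain ⟨⟨h1, h2⟩, h3, h4⟩ := ih
      refine ⟨⟨h3, h4⟩, ?_, ?_⟩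
      · rw [leg]
        refine (natDegree_sub_le _ _).trans (max_le ?_ ?_)
        · rw [mul_assoc]
          refine (natDegree_C_mul_le _ _).trans (natDegree_mul_le.trans ?_)
          rw [natDegree_X]; omega
        · exact (natDegree_C_mul_le _ _).trans (by omega)
      · rw [leg, coeff_sub, mul_assoc, coeff_C_mul, coeff_X_mul, coeff_C_mul,
          coeff_eq_zero_of_natDegree_lt (by omega : (leg n).natDegree < n + 1 + 1)]
        have : (0 : ℝ) < (2 * n + 3) / (n + 2) := by positivity
        simpa using mul_pos this h4
  exact h.1

theorem natDegree_leg_le (n : ℕ) : (leg n).natDegree ≤ n := (degree_leg_aux n).1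

theorem coeff_leg_pos (n : ℕ) : 0 < (leg n).coeff n := (degree_leg_aux n).2

theorem intervalIntegrable_eval (p : ℝ[X]) (a b : ℝ) :
    IntervalIntegrable (fun x => p.eval x) volume a b :=
  p.continuous.intervalIntegrable a b

theorem integral_eval_derivative (p : ℝ[X]) (a b : ℝ) :
    ∫ x in a..b, (derivative p).eval x = p.eval b - p.eval a :=
  intervalIntegral.integral_eq_sub_of_hasDerivAt (fun x _ => p.hasDerivAt x)
    (intervalIntegrable_eval _ a b)

/-- Self-adjointness of the Legendre operator: the difference of eigenvalues times `P_m P_n` is an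
exact derivative whose primitive carries the factor `x² - 1`, zero at both endpoints. -/
theorem integral_leg_mul_leg_of_ne {m n : ℕ} (h : m ≠ n) :
    ∫ x in (-1 : ℝ)..1, (leg m * leg n).eval x = 0 := by
  have hd : derivative ((X ^ 2 - 1) * (derivative (leg m) * leg n - derivative (leg n) * leg m)) =
      C ((m * (m + 1) - n * (n + 1) : ℝ)) * (leg m * leg n) := by
    have h1 := legendre_ode m
    have h2 := legendre_ode n
    simp only [derivative_mul, derivative_sub, derivative_X_pow, derivative_one, C_sub] at *
    linear_combination leg n * h1 - leg m * h2
  have hi := integral_eval_derivative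
    ((X ^ 2 - 1) * (derivative (leg m) * leg n - derivative (leg n) * leg m)) (-1) 1
  rw [hd] at hi
  simp only [eval_mul, eval_C, eval_sub, eval_pow, eval_X, eval_one] at hi
  rw [intervalIntegral.integral_const_mul] at hi
  norm_num at hi
  simp only [eval_mul]
  rcases hi with hi | hi
  · exfalso
    apply h
    have : ((m : ℝ) - n) * (m + n + 1) = 0 := by linear_combination hi
    rcases mul_eq_zero.1 this with h | h
    · exact_mod_cast sub_eq_zero.1 h
    · have : (0 : ℝ) < m + n + 1 := by positivity
      linarith
  · exact hi

theorem integral_eval_add (p q : ℝ[X]) (a b : ℝ) :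
    ∫ x in a..b, (p + q).eval x = (∫ x in a..b, p.eval x) + ∫ x in a..b, q.eval x := by
  simp only [eval_add]
  exact intervalIntegral.integral_add (intervalIntegrable_eval p a b) (intervalIntegrable_eval q a b)

theorem integral_eval_C_mul (c : ℝ) (p : ℝ[X]) (a b : ℝ) :
    ∫ x in a..b, (C c * p).eval x = c * ∫ x in a..b, p.eval x := by
  simp only [eval_mul, eval_C, intervalIntegral.integral_const_mul]

/-- The recurrence for `P_{n+2}` tested against `P_n`, and the one for `P_{n+1}` tested against
`P_{n+1}`, both involve the integral of `x P_n P_{n+1}`. Orthogonality removes one term from each,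
which links consecutive norms. -/
theorem integral_leg_mul_self (n : ℕ) :
    ∫ x in (-1 : ℝ)..1, (leg n * leg n).eval x = 2 / (2 * n + 1) := by
  have hrec : ∀ (n : ℕ) (q : ℝ[X]), (n + 2) * ∫ x in (-1 : ℝ)..1, (leg (n + 2) * q).eval x =
      (2 * n + 3) * (∫ x in (-1 : ℝ)..1, (X * leg (n + 1) * q).eval x) -
        (n + 1) * ∫ x in (-1 : ℝ)..1, (leg n * q).eval x := by
    intro n q
    rw [← integral_eval_C_mul, ← integral_eval_C_mul, ← integral_eval_C_mul, eq_sub_iff_add_eq,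
      ← integral_eval_add]
    congr 1
    ext x
    congr 1
    linear_combination q * leg_rec n
  induction n with
  | zero => simp [leg_zero]; norm_num
  | succ n ih =>
    have h1 := hrec n (leg n)
    rw [integral_leg_mul_leg_of_ne (by omega), ih] at h1
    cases n with
    | zero =>
      simp only [zero_add, leg_one, eval_mul, eval_X]
      norm_num
      rw [show (fun x : ℝ => x * x) = fun x => x ^ 2 by ext; ring, integral_pow]
      norm_num
    | succ n =>
      have h2 := hrec n (leg (n + 2))
      rw [integral_leg_mul_leg_of_ne (by omega : n ≠ n + 2)] at h2
      rw [show X * leg (n + 1) * leg (n + 2) = X * leg (n + 1 + 1) * leg (n + 1) by ring] at h2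
      generalize (∫ x in (-1 : ℝ)..1, (X * leg (n + 1 + 1) * leg (n + 1)).eval x) = A at h1 h2
      have h3 : A = 2 * (n + 2) / ((2 * n + 3) * (2 * n + 5)) := by
        push_cast at h1
        field_simp
        field_simp at h1
        linarith
      have h4 : (n + 2 : ℝ) * ∫ x in (-1 : ℝ)..1, (leg (n + 2) * leg (n + 2)).eval x =
          (n + 2) * (2 / (2 * n + 5)) := by
        rw [h2, h3]; field_simp; ring
      have := mul_left_cancel₀ (by positivity) h4
      rw [this]; push_cast; ring

/-! ### Signs and Vandermonde products -/

/-- The sign of a real number, as a real number. -/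
noncomputable def sgn (x : ℝ) : ℝ := x / |x|

theorem sgn_mul (x y : ℝ) : sgn (x * y) = sgn x * sgn y := by
  rw [sgn, abs_mul, mul_div_mul_comm]; rfl

theorem sgn_one : sgn 1 = 1 := by simp [sgn]

theorem sgn_neg (x : ℝ) : sgn (-x) = -sgn x := by simp [sgn, neg_div]

theorem sgn_sub_comm (x y : ℝ) : sgn (x - y) = -sgn (y - x) := by
  rw [← sgn_neg, neg_sub]

theorem sgn_of_pos {x : ℝ} (h : 0 < x) : sgn x = 1 := by
  rw [sgn, abs_of_pos h, div_self h.ne']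

theorem sgn_of_neg {x : ℝ} (h : x < 0) : sgn x = -1 := by
  rw [sgn, abs_of_neg h, div_neg, div_self h.ne]

theorem sgn_mul_self {x : ℝ} (h : x ≠ 0) : sgn x * sgn x = 1 := by
  rcases h.lt_or_gt with h | h
  · simp [sgn_of_neg h]
  · simp [sgn_of_pos h]

theorem sgn_mul_eq_abs (x : ℝ) : sgn x * x = |x| := by
  rcases lt_trichotomy x 0 with h | h | h
  · rw [sgn_of_neg h, abs_of_neg h]; ring
  · simp [h]
  · rw [sgn_of_pos h, abs_of_pos h, one_mul]

theorem abs_sgn_le_one (x : ℝ) : |sgn x| ≤ 1 := by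
  rw [sgn, abs_div, abs_abs]; exact div_self_le_one _

theorem measurable_sgn : Measurable sgn := measurable_id.div measurable_id.abs

theorem sgn_prod {ι : Type*} (s : Finset ι) (f : ι → ℝ) :
    sgn (∏ i ∈ s, f i) = ∏ i ∈ s, sgn (f i) :=
  map_prod (⟨⟨sgn, sgn_one⟩, sgn_mul⟩ : ℝ →* ℝ) f s

/-- The product of the differences `x i - x j` with `i < j`. -/
def vdm {R : Type*} [CommRing R] {m : ℕ} (x : Fin m → R) : R :=
  ∏ i, ∏ j ∈ Finset.Ioi i, (x i - x j)

theorem vdm_vecCons {R : Type*} [CommRing R] {m : ℕ} (t : R) (w : Fin m → R) :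
    vdm (Matrix.vecCons t w) = (∏ k, (t - w k)) * vdm w := by
  simp [vdm, Fin.prod_univ_succ]

theorem vdm_eq_det {R : Type*} [CommRing R] {m : ℕ} (x : Fin m → R) :
    vdm x = (Matrix.vandermonde fun i => -x i).det := by
  rw [Matrix.det_vandermonde]
  simp only [vdm]
  refine Finset.prod_congr rfl fun i _ => Finset.prod_congr rfl fun j _ => by ring

theorem vdm_comp_perm {R : Type*} [CommRing R] {m : ℕ} (x : Fin m → R) (σ : Equiv.Perm (Fin m)) :
    vdm (x ∘ σ) = ((Equiv.Perm.sign σ : ℤ) : R) * vdm x := by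
  rw [vdm_eq_det, vdm_eq_det, ← Matrix.det_permute σ]
  rfl

theorem vdm_ne_zero_iff {R : Type*} [CommRing R] [IsDomain R] {m : ℕ} {x : Fin m → R} :
    vdm x ≠ 0 ↔ Function.Injective x := by
  rw [vdm_eq_det, Matrix.det_vandermonde_ne_zero_iff]
  exact neg_injective.of_comp_iff x

theorem sgn_sign {m : ℕ} (σ : Equiv.Perm (Fin m)) :
    sgn ((Equiv.Perm.sign σ : ℤ) : ℝ) = ((Equiv.Perm.sign σ : ℤ) : ℝ) := by
  rcases Int.units_eq_one_or (Equiv.Perm.sign σ) with h | h <;> simp [h, sgn]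

/-- The three differences sum to zero, so their signs are not all equal: one pair agrees and two
pairs disagree. -/
theorem sgn_three {a b c : ℝ} (hab : a ≠ b) (hbc : b ≠ c) (hca : c ≠ a) :
    sgn (a - b) * sgn (b - c) + sgn (b - c) * sgn (c - a) + sgn (c - a) * sgn (a - b) = -1 := by
  rcases hab.lt_or_gt with h1 | h1 <;> rcases hbc.lt_or_gt with h2 | h2 <;>
    rcases hca.lt_or_gt with h3 | h3
  all_goals first
    | exact absurd (h1.trans (h2.trans h3)) (lt_irrefl _)
    | skip
  all_goals first
    | rw [sgn_of_neg (sub_neg.2 h1)]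
    | rw [sgn_of_pos (sub_pos.2 h1)]
  all_goals first
    | rw [sgn_of_neg (sub_neg.2 h2)]
    | rw [sgn_of_pos (sub_pos.2 h2)]
  all_goals first
    | rw [sgn_of_neg (sub_neg.2 h3)]
    | rw [sgn_of_pos (sub_pos.2 h3)]
  all_goals linarith

/-- The product of the signs of the differences between `w k` and the other points. -/
noncomputable def eps {m : ℕ} (w : Fin m → ℝ) (k : Fin m) : ℝ :=
  ∏ l, if l = k then 1 else sgn (w k - w l)

theorem eps_zero {m : ℕ} (w : Fin (m + 1) → ℝ) :
    eps w 0 = ∏ l : Fin m, sgn (w 0 - w l.succ) := by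
  simp [eps, Fin.prod_univ_succ]

theorem eps_succ {m : ℕ} (w : Fin (m + 1) → ℝ) (k : Fin m) :
    eps w k.succ = sgn (w k.succ - w 0) * eps (fun i => w i.succ) k := by
  simp [eps, Fin.prod_univ_succ, (Fin.succ_ne_zero k).symm]

/-- As a function of `t` the product is piecewise constant and jumps by `2 * eps w k` at `w k`; its
limits at `±∞` fix the constant and the sum of the jumps. The induction splits off `w 0` and
linearizes products of two signs by `sgn_three`, for which both statements are needed. -/
theorem prod_sgn_sub_aux (m : ℕ) (w : Fin m → ℝ) (hw : Function.Injective w) :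
    (∀ t, (∀ k, t ≠ w k) → ∏ k, sgn (t - w k) =
      (if Even m then 1 else 0) + ∑ k, eps w k * sgn (t - w k)) ∧
    ∑ k, eps w k = if Even m then 0 else 1 := by
  induction m with
  | zero => simp
  | succ m ih =>
    obtain ⟨h1, h2⟩ := ih (fun i => w i.succ) (hw.comp (Fin.succ_injective m))
    have h0 : ∀ k : Fin m, w 0 ≠ w k.succ := fun k h => (Fin.succ_ne_zero k) (hw h).symm
    have e0 := h1 (w 0) h0
    have key : (if Even (m + 1) then (1 : ℝ) else 0) = if Even m then 0 else 1 := by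
      simp only [Nat.even_add_one]; split_ifs <;> simp_all
    have key' : (if Even (m + 1) then (0 : ℝ) else 1) = if Even m then 1 else 0 := by
      simp only [Nat.even_add_one]; split_ifs <;> simp_all
    refine ⟨fun t ht => ?_, ?_⟩
    · have e1 := h1 t (fun k => ht k.succ)
      rw [key, Fin.prod_univ_succ, Fin.sum_univ_succ, eps_zero, ← h2, e0, e1]
      have : ∀ k : Fin m, eps w k.succ * sgn (t - w k.succ) =
          eps (fun i => w i.succ) k * (-1 + sgn (t - w 0) * sgn (t - w k.succ)
            - sgn (t - w 0) * sgn (w 0 - w k.succ)) := by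
        intro k
        rw [eps_succ]
        have := sgn_three (ht k.succ) (h0 k).symm (ht 0).symm
        rw [sgn_sub_comm (w 0) t, sgn_sub_comm (w k.succ) (w 0)] at this
        rw [sgn_sub_comm (w k.succ) (w 0)]
        linear_combination eps (fun i => w i.succ) k * this
      simp only [this, mul_add, mul_sub, Finset.sum_add_distrib, Finset.sum_sub_distrib,
        mul_neg, mul_one, Finset.sum_neg_distrib, Finset.mul_sum]
      have c1 : ∀ k : Fin m, eps (fun i => w i.succ) k * (sgn (t - w 0) * sgn (t - w k.succ)) =
        sgn (t - w 0) * (eps (fun i => w i.succ) k * sgn (t - w k.succ)) := fun k => by ring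
      have c2 : ∀ k : Fin m, eps (fun i => w i.succ) k * (sgn (t - w 0) * sgn (w 0 - w k.succ)) =
        sgn (t - w 0) * (eps (fun i => w i.succ) k * sgn (w 0 - w k.succ)) := fun k => by ring
      simp only [c1, c2, ← Finset.mul_sum]
      ring
    · rw [key', Fin.sum_univ_succ, eps_zero, e0]
      have : ∀ k : Fin m, eps w k.succ =
          -(eps (fun i => w i.succ) k * sgn (w 0 - w k.succ)) := by
        intro k
        rw [eps_succ, sgn_sub_comm]; ring
      simp only [this, Finset.sum_neg_distrib]
      ring

/-- For pairwise distinct points, the product of the signs of `t - w k` is an affine combination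
of these signs. -/
theorem prod_sgn_sub {m : ℕ} {w : Fin m → ℝ} (hw : Function.Injective w) {t : ℝ}
    (ht : ∀ k, t ≠ w k) :
    ∏ k, sgn (t - w k) = (if Even m then 1 else 0) + ∑ k, eps w k * sgn (t - w k) :=
  (prod_sgn_sub_aux m w hw).1 t ht

/-! ### Integration over cubes -/

/-- Lebesgue measure on the interval `(-1, 1]`. -/
noncomputable def seg : Measure ℝ := volume.restrict (Set.Ioc (-1) 1)

/-- Lebesgue measure on the cube `(-1, 1]^m`. -/
noncomputable def cube (m : ℕ) : Measure (Fin m → ℝ) := Measure.pi fun _ => seg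

instance : IsFiniteMeasure seg := by unfold seg; infer_instance

instance (m : ℕ) : IsFiniteMeasure (cube m) := by unfold cube; infer_instance

theorem integral_seg (f : ℝ → ℝ) : ∫ x, f x ∂seg = ∫ x in (-1 : ℝ)..1, f x := by
  rw [intervalIntegral.integral_of_le (by norm_num)]; rfl

theorem cube_eq_restrict (m : ℕ) :
    cube m = volume.restrict (Set.univ.pi fun _ => Set.Ioc (-1) 1) :=
  (Measure.restrict_pi_pi (fun _ : Fin m => (volume : Measure ℝ)) _).symm

theorem integrable_cube {m : ℕ} {f : (Fin m → ℝ) → ℝ} (hf : Continuous f) :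
    Integrable f (cube m) := by
  rw [cube_eq_restrict]
  refine (hf.integrableOn_Icc (a := fun _ => -1) (b := fun _ => 1)).mono_set ?_
  intro x hx
  simp only [Set.mem_pi, Set.mem_univ, forall_true_left, Set.mem_Ioc] at hx
  exact ⟨fun i => (hx i).1.le, fun i => (hx i).2⟩

theorem integrable_seg {f : ℝ → ℝ} (hf : Continuous f) : Integrable f seg :=
  (hf.integrableOn_Icc (a := -1) (b := 1)).mono_set Set.Ioc_subset_Icc_self

theorem integrable_mul_of_abs_le_one {α : Type*} [MeasurableSpace α] {μ : Measure α}
    {s f : α → ℝ} (hs : Measurable s)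
    (hs1 : ∀ x, |s x| ≤ 1) (hf : Integrable f μ) : Integrable (fun x => s x * f x) μ :=
  hf.bdd_mul (c := 1) hs.aestronglyMeasurable (Filter.Eventually.of_forall hs1)

theorem continuous_vdm (m : ℕ) : Continuous (vdm : (Fin m → ℝ) → ℝ) := by
  unfold vdm; fun_prop

theorem measurable_sgn_vdm (m : ℕ) : Measurable fun x : Fin m → ℝ => sgn (vdm x) :=
  measurable_sgn.comp (continuous_vdm m).measurable

theorem integral_cube_succ {m : ℕ} {f : (Fin (m + 1) → ℝ) → ℝ} (hf : Integrable f (cube (m + 1))) :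
    ∫ x, f x ∂cube (m + 1) = ∫ w, ∫ t, f (Matrix.vecCons t w) ∂seg ∂cube m := by
  have hp := (measurePreserving_piFinSuccAbove (fun _ : Fin (m + 1) => seg) 0).symm
  have hi := (hp.integrable_comp_emb (MeasurableEquiv.measurableEmbedding _)).2 hf
  rw [cube, ← hp.integral_comp']
  refine (integral_prod_symm _ hi).trans ?_
  refine integral_congr_ae (Filter.Eventually.of_forall fun w => ?_)
  refine integral_congr_ae (Filter.Eventually.of_forall fun t => ?_)
  simp only [MeasurableEquiv.piFinSuccAbove_symm_apply, Fin.insertNthEquiv]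
  simp
  rfl

theorem integral_cube_comp_perm {m : ℕ} (σ : Equiv.Perm (Fin m)) (f : (Fin m → ℝ) → ℝ) :
    ∫ x, f (x ∘ σ) ∂cube m = ∫ x, f x ∂cube m := by
  have h := measurePreserving_arrowCongr' (fun _ : Fin m => seg) (fun _ : Fin m => seg) σ.symm
    (MeasurableEquiv.refl ℝ) (fun _ => MeasurePreserving.id _)
  exact h.integral_comp' f

theorem volume_eq_coord (m : ℕ) {i j : Fin m} (h : i ≠ j) :
    volume {x : Fin m → ℝ | x i = x j} = 0 := by
  let S : Submodule ℝ (Fin m → ℝ) :=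
    LinearMap.ker ((LinearMap.proj i : (Fin m → ℝ) →ₗ[ℝ] ℝ) - LinearMap.proj j)
  have hS : S ≠ ⊤ := by
    intro hS
    have : (Pi.single i 1 : Fin m → ℝ) ∈ S := hS ▸ Submodule.mem_top
    simp [S, h.symm] at this
  have h0 := Measure.addHaar_submodule (volume : Measure (Fin m → ℝ)) S hS
  convert h0 using 2
  ext x
  simp [S, sub_eq_zero]

theorem ae_injective_volume (m : ℕ) : ∀ᵐ x : Fin m → ℝ, Function.Injective x := by
  have : ∀ᵐ x : Fin m → ℝ, ∀ i j, i ≠ j → x i ≠ x j := by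
    simp only [ae_all_iff]
    intro i j h
    exact measure_eq_zero_iff_ae_notMem.1 (volume_eq_coord m h)
  filter_upwards [this] with x hx i j hij
  by_contra h
  exact hx i j h hij

theorem ae_injective_cube (m : ℕ) : ∀ᵐ x ∂cube m, Function.Injective x := by
  rw [cube_eq_restrict]
  exact ae_restrict_of_ae (ae_injective_volume m)

theorem ae_ne_seg {m : ℕ} (w : Fin m → ℝ) : ∀ᵐ t ∂seg, ∀ k, t ≠ w k := by
  rw [ae_all_iff]
  intro k
  refine ae_restrict_of_ae ?_
  exact measure_eq_zero_iff_ae_notMem.1 (by simp : volume {w k} = 0)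

/-! ### Integrating alternating forms along the Legendre curve -/

/-- The Legendre polynomials scaled so that consecutive ones have skew product `1`. -/
noncomputable def fleg (n : ℕ) : ℝ[X] := C ((2 * n + 1) / 2 : ℝ) * leg n

variable {V : Type*} [AddCommGroup V] [Module ℝ V]

/-- The curve with coordinates `fleg 0, …, fleg (n - 1)` with respect to `e`. -/
noncomputable def rho (e : ℕ → V) (n : ℕ) (x : ℝ) : V :=
  ∑ j ∈ Finset.range n, (fleg j).eval x • e j

theorem rho_succ (e : ℕ → V) (n : ℕ) (x : ℝ) :
    rho e (n + 1) x = rho e n x + (fleg n).eval x • e n := Finset.sum_range_succ _ _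

/-- The integral over the cube of an alternating form along the curve `rho e n`, with the sign
that makes the integrand symmetric. -/
noncomputable def pf (e : ℕ → V) (n : ℕ) {m : ℕ} (Φ : V [⋀^Fin m]→ₗ[ℝ] ℝ) : ℝ :=
  ∫ x, sgn (vdm x) * Φ (fun i => rho e n (x i)) ∂cube m

/-- `V` carries no topology, so continuity is read off the multilinear expansion, a polynomial in
the coordinates of `x`. -/
theorem continuous_rho (e : ℕ → V) (n : ℕ) {m : ℕ} (Φ : V [⋀^Fin m]→ₗ[ℝ] ℝ) :
    Continuous fun x : Fin m → ℝ => Φ (fun i => rho e n (x i)) := by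
  have : ∀ x : Fin m → ℝ, Φ (fun i => rho e n (x i)) =
      ∑ r ∈ Fintype.piFinset fun _ : Fin m => Finset.range n,
        (∏ i, (fleg (r i)).eval (x i)) * Φ (fun i => e (r i)) := by
    intro x
    have h := Φ.toMultilinearMap.map_sum_finset (fun i j => (fleg j).eval (x i) • e j)
      (fun _ => Finset.range n)
    refine h.trans (Finset.sum_congr rfl fun r _ => ?_)
    exact Φ.toMultilinearMap.map_smul_univ _ _
  simp only [this]
  refine continuous_finsetSum _ fun r _ => Continuous.mul ?_ continuous_const
  exact continuous_finsetProd _ fun i _ => (fleg (r i)).continuous.comp (continuous_apply i)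

theorem update_vecCons_zero {α : Type*} {m : ℕ} (x y : α) (v : Fin m → α) :
    Function.update (Matrix.vecCons x v) 0 y = Matrix.vecCons y v := Fin.update_cons_zero _ _ _

theorem update_vecCons_succ {α : Type*} {m : ℕ} (x y : α) (v : Fin m → α) (i : Fin m) :
    Function.update (Matrix.vecCons x v) i.succ y = Matrix.vecCons x (Function.update v i y) :=
  (Fin.cons_update _ _ _ _).symm

theorem curryLeft_update_self {m : ℕ} (Φ : V [⋀^Fin (m + 1)]→ₗ[ℝ] ℝ) (u : V) (v : Fin m → V)
    (i : Fin m) : Φ.curryLeft u (Function.update v i u) = 0 := by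
  rw [AlternatingMap.curryLeft_apply_apply]
  exact Φ.map_eq_zero_of_eq _ (i := 0) (j := i.succ) (by simp) (Fin.succ_ne_zero i).symm

/-- In the multilinear expansion every term with `u` in two slots vanishes, so the perturbation is
exactly of first order. -/
theorem map_add_smul {m : ℕ} (Φ : V [⋀^Fin m]→ₗ[ℝ] ℝ) (v : Fin m → V) (a : Fin m → ℝ) (u : V) :
    Φ (fun i => v i + a i • u) = Φ v + ∑ i, a i * Φ (Function.update v i u) := by
  induction m with
  | zero => simp; congr 1; ext i; exact i.elim0
  | succ m ih =>
    have hv : v = Matrix.vecCons (v 0) (fun i => v i.succ) := (Matrix.cons_head_tail v).symm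
    have h1 : (fun i => v i + a i • u) = Matrix.vecCons (v 0 + a 0 • u)
        (fun i => v i.succ + a i.succ • u) := by
      ext i; cases i using Fin.cases <;> simp
    have ih1 := ih (Φ.curryLeft (v 0)) (fun i => v i.succ) (fun i => a i.succ)
    have ih2 := ih (Φ.curryLeft u) (fun i => v i.succ) (fun i => a i.succ)
    simp only [curryLeft_update_self, mul_zero, Finset.sum_const_zero, add_zero] at ih2
    simp only [AlternatingMap.curryLeft_apply_apply] at ih1 ih2
    rw [h1, Φ.map_vecCons_add, Φ.map_vecCons_smul, ih1, ih2, Fin.sum_univ_succ]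
    simp only [smul_eq_mul]
    have e0 : Function.update v 0 u = Matrix.vecCons u (fun i => v i.succ) := by
      conv_lhs => rw [hv]
      exact update_vecCons_zero _ _ _
    have e1 : ∀ i : Fin m, Function.update v i.succ u =
        Matrix.vecCons (v 0) (Function.update (fun i => v i.succ) i u) := by
      intro i
      conv_lhs => rw [hv]
      exact update_vecCons_succ _ _ _ _
    simp only [e0, e1, ← hv]
    ring

theorem curryLeft_rho_succ (e : ℕ → V) (n : ℕ) {m : ℕ} (Φ : V [⋀^Fin (m + 1)]→ₗ[ℝ] ℝ)
    (x : Fin m → ℝ) : Φ.curryLeft (e n) (fun i => rho e (n + 1) (x i)) =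
      Φ.curryLeft (e n) (fun i => rho e n (x i)) := by
  simp only [rho_succ]
  rw [map_add_smul]
  simp only [curryLeft_update_self, mul_zero, Finset.sum_const_zero, add_zero]

theorem pf_curryLeft_succ (e : ℕ → V) (n : ℕ) {m : ℕ} (Φ : V [⋀^Fin (m + 1)]→ₗ[ℝ] ℝ) :
    pf e (n + 1) (Φ.curryLeft (e n)) = pf e n (Φ.curryLeft (e n)) := by
  simp only [pf, curryLeft_rho_succ]

theorem comp_vecCons {α β : Type*} {m : ℕ} (f : α → β) (t : α) (w : Fin m → α) :
    (fun i => f (Matrix.vecCons t w i)) = Matrix.vecCons (f t) (fun i => f (w i)) := by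
  ext i; cases i using Fin.cases <;> simp

theorem integrable_aux (e : ℕ → V) (k : ℕ) {m : ℕ} (Φ : V [⋀^Fin (m + 1)]→ₗ[ℝ] ℝ) (i : Fin (m + 1)) :
    Integrable (fun x : Fin (m + 1) → ℝ => sgn (vdm x) * ((fleg k).eval (x i) *
      Φ (Function.update (fun i => rho e k (x i)) i (e k)))) (cube (m + 1)) := by
  refine integrable_mul_of_abs_le_one (measurable_sgn_vdm _) (fun _ => abs_sgn_le_one _) ?_
  refine integrable_cube ?_
  refine ((fleg k).continuous.comp (continuous_apply i)).mul ?_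
  have : ∀ x : Fin (m + 1) → ℝ, Φ (Function.update (fun i => rho e k (x i)) i (e k)) =
      (-1) ^ (i : ℕ) * (Φ.curryLeft (e k)) (fun j => rho e k (x (i.succAbove j))) := by
    intro x
    have := Φ.map_insertNth i (e k) (fun j => rho e k (x (i.succAbove j)))
    rw [zsmul_eq_mul] at this
    push_cast at this
    rw [AlternatingMap.curryLeft_apply_apply, ← this]
    congr 1
    ext j
    cases j using Fin.succAboveCases i <;> simp
  simp only [this]
  exact continuous_const.mul ((continuous_rho e k _).comp (by fun_prop))

/-- The new component `e k` can occupy only one slot, and by symmetry all `m + 1` slots contribute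
equally. With it in slot `0`, the variable `t` of that slot enters only through `fleg k` and the
signs of `t - w j`, so it can be integrated out. -/
theorem pf_succ_succ (e : ℕ → V) (k : ℕ) {m : ℕ} (Φ : V [⋀^Fin (m + 1)]→ₗ[ℝ] ℝ) :
    pf e (k + 1) Φ = pf e k Φ + (m + 1) * ∫ w, sgn (vdm w) *
      ((Φ.curryLeft (e k)) (fun i => rho e k (w i)) *
        ∫ t, (∏ j, sgn (t - w j)) * (fleg k).eval t ∂seg) ∂cube m := by
  have h1 : ∀ x : Fin (m + 1) → ℝ, sgn (vdm x) * Φ (fun i => rho e (k + 1) (x i)) =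
      sgn (vdm x) * Φ (fun i => rho e k (x i)) + ∑ i, sgn (vdm x) * ((fleg k).eval (x i) *
        Φ (Function.update (fun i => rho e k (x i)) i (e k))) := by
    intro x
    simp only [rho_succ]
    rw [map_add_smul, mul_add, Finset.mul_sum]
  have h2 : ∀ i : Fin (m + 1), ∫ x : Fin (m + 1) → ℝ, sgn (vdm x) * ((fleg k).eval (x i) *
      Φ (Function.update (fun i => rho e k (x i)) i (e k))) ∂cube (m + 1) =
      ∫ x : Fin (m + 1) → ℝ, sgn (vdm x) * ((fleg k).eval (x 0) *
      Φ (Function.update (fun i => rho e k (x i)) 0 (e k))) ∂cube (m + 1) := by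
    -- The transposition carries slot `i` to slot `0`; the sign of the Vandermonde product and `Φ`
    -- both change by its signature, and the two changes cancel.
    intro i
    rw [← integral_cube_comp_perm (Equiv.swap 0 i)]
    refine integral_congr_ae (Filter.Eventually.of_forall fun x => ?_)
    have hu : Function.update (fun j => rho e k ((x ∘ Equiv.swap 0 i) j)) i (e k) =
        Function.update (fun j => rho e k (x j)) 0 (e k) ∘ Equiv.swap 0 i := by
      rw [Function.update_comp_equiv]
      simp
      rfl
    simp only [hu, Φ.map_perm, vdm_comp_perm, sgn_mul, sgn_sign]
    rcases Int.units_eq_one_or (Equiv.Perm.sign (Equiv.swap 0 i)) with h | h <;> simp [h]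
  rw [pf, integral_congr_ae (Filter.Eventually.of_forall h1), integral_add, integral_finsetSum,
    Finset.sum_congr rfl fun i _ => h2 i]
  · rw [Finset.sum_const, Finset.card_univ, Fintype.card_fin, nsmul_eq_mul, pf]
    push_cast
    congr 2
    rw [integral_cube_succ (integrable_aux e k Φ 0)]
    refine integral_congr_ae (Filter.Eventually.of_forall fun w => ?_)
    simp only [comp_vecCons (rho e k), update_vecCons_zero, vdm_vecCons, sgn_mul, sgn_prod,
      AlternatingMap.curryLeft_apply_apply, Matrix.cons_val_zero]
    rw [← mul_assoc, ← integral_const_mul]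
    refine integral_congr_ae (Filter.Eventually.of_forall fun t => ?_)
    simp only
    ring
  · exact fun i _ => integrable_aux e k Φ i
  · exact integrable_mul_of_abs_le_one (measurable_sgn_vdm _) (fun _ => abs_sgn_le_one _)
      (integrable_cube (continuous_rho e k Φ))
  · exact integrable_finsetSum _ fun i _ => integrable_aux e k Φ i

/-! ### Sign kernels against Legendre polynomials, and the two-step recursion -/

theorem derivative_leg_sub (n : ℕ) :
    derivative (C (1 / 2 : ℝ) * (leg (n + 2) - leg n)) = fleg (n + 1) := by
  rw [derivative_C_mul, derivative_sub, derivative_leg_add_two, fleg, ← mul_assoc, ← C_mul]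
  congr 2
  push_cast; ring

theorem integral_fleg_succ (n : ℕ) (a b : ℝ) : ∫ t in a..b, (fleg (n + 1)).eval t =
    ((leg (n + 2)).eval b - (leg n).eval b) / 2 - ((leg (n + 2)).eval a - (leg n).eval a) / 2 := by
  rw [← derivative_leg_sub, integral_eval_derivative]
  simp only [eval_mul, eval_C, eval_sub]
  ring

/-- The primitive `(P_{n+2} - P_n) / 2` of `fleg (n + 1)` vanishes at both endpoints, so each side
of `a` contributes minus its value at `a`. -/
theorem integral_sgn_mul_fleg (n : ℕ) {a : ℝ} (ha : a ∈ Set.Ioc (-1 : ℝ) 1) :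
    ∫ t, sgn (t - a) * (fleg (n + 1)).eval t ∂seg = (leg n).eval a - (leg (n + 2)).eval a := by
  have hi := integrable_mul_of_abs_le_one (s := fun t => sgn (t - a))
    (measurable_sgn.comp (measurable_id.sub_const a)) (fun _ => abs_sgn_le_one _)
    (integrable_seg (fleg (n + 1)).continuous)
  rw [integral_seg]
  have hI : IntervalIntegrable (fun t => sgn (t - a) * (fleg (n + 1)).eval t) volume (-1) 1 := by
    rw [intervalIntegrable_iff_integrableOn_Ioc_of_le (by norm_num)]; exact hi
  rw [← intervalIntegral.integral_add_adjacent_intervals (b := a)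
    (hI.mono_set (by
      rw [Set.uIcc_of_le ha.1.le, Set.uIcc_of_le (by norm_num)]
      exact Set.Icc_subset_Icc_right ha.2))
    (hI.mono_set (by
      rw [Set.uIcc_of_le ha.2, Set.uIcc_of_le (by norm_num)]
      exact Set.Icc_subset_Icc_left ha.1.le))]
  have e1 : ∫ t in (-1)..a, sgn (t - a) * (fleg (n + 1)).eval t =
      ∫ t in (-1)..a, -(fleg (n + 1)).eval t := by
    refine intervalIntegral.integral_congr_ae ?_
    have : ∀ᵐ t : ℝ, t ≠ a := measure_eq_zero_iff_ae_notMem.1 (by simp : volume {a} = 0)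
    filter_upwards [this] with t ht hm
    rw [Set.uIoc_of_le ha.1.le] at hm
    rw [sgn_of_neg (sub_neg.2 (lt_of_le_of_ne hm.2 ht)), neg_one_mul]
  have e2 : ∫ t in a..1, sgn (t - a) * (fleg (n + 1)).eval t =
      ∫ t in a..1, (fleg (n + 1)).eval t := by
    refine intervalIntegral.integral_congr_ae (Filter.Eventually.of_forall fun t hm => ?_)
    rw [Set.uIoc_of_le ha.2] at hm
    rw [sgn_of_pos (sub_pos.2 hm.1), one_mul]
  rw [e1, e2, intervalIntegral.integral_neg, integral_fleg_succ, integral_fleg_succ,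
    eval_one_leg, eval_one_leg, eval_neg_one_leg, eval_neg_one_leg]
  ring

/-- Linearizing the product of signs reduces this to single signs; the parity constant drops out
because `fleg (n + 1)` has mean zero. -/
theorem integral_prod_sgn_mul_fleg (n : ℕ) {m : ℕ} {w : Fin m → ℝ} (hw : Function.Injective w)
    (hm : ∀ k, w k ∈ Set.Ioc (-1 : ℝ) 1) :
    ∫ t, (∏ j, sgn (t - w j)) * (fleg (n + 1)).eval t ∂seg =
      ∑ k, eps w k * ((leg n).eval (w k) - (leg (n + 2)).eval (w k)) := by
  have h0 : ∫ t, (fleg (n + 1)).eval t ∂seg = 0 := by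
    rw [integral_seg, integral_fleg_succ, eval_one_leg, eval_one_leg, eval_neg_one_leg,
      eval_neg_one_leg]
    ring
  have h1 : ∀ᵐ t ∂seg, (∏ j, sgn (t - w j)) * (fleg (n + 1)).eval t =
      (if Even m then 1 else 0) * (fleg (n + 1)).eval t +
        ∑ k, eps w k * (sgn (t - w k) * (fleg (n + 1)).eval t) := by
    filter_upwards [ae_ne_seg w] with t ht
    rw [prod_sgn_sub hw ht, add_mul, Finset.sum_mul]
    simp only [mul_assoc]
  have hi : ∀ k, Integrable (fun t => sgn (t - w k) * (fleg (n + 1)).eval t) seg := fun k =>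
    integrable_mul_of_abs_le_one (s := fun t => sgn (t - w k))
      (measurable_sgn.comp (measurable_id.sub_const _)) (fun _ => abs_sgn_le_one _)
      (integrable_seg (fleg (n + 1)).continuous)
  rw [integral_congr_ae h1, integral_add, integral_const_mul, h0, integral_finsetSum]
  · simp only [integral_const_mul, integral_sgn_mul_fleg n (hm _), mul_zero, zero_add]
  · exact fun k _ => (hi k).const_mul _
  · exact (integrable_seg (fleg (n + 1)).continuous).const_mul _
  · exact integrable_finsetSum _ fun k _ => (hi k).const_mul _

theorem ae_mem_cube (m : ℕ) : ∀ᵐ w ∂cube m, ∀ k, w k ∈ Set.Ioc (-1 : ℝ) 1 := by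
  rw [cube_eq_restrict]
  filter_upwards [ae_restrict_mem (MeasurableSet.univ_pi fun _ => measurableSet_Ioc)] with w hw k
  exact hw k (Set.mem_univ k)

theorem eps_comp_perm {m : ℕ} (w : Fin m → ℝ) (σ : Equiv.Perm (Fin m)) (k : Fin m) :
    eps (w ∘ σ) k = eps w (σ k) := by
  unfold eps
  refine Eq.trans ?_ (Equiv.prod_comp σ _)
  simp

theorem measurable_eps {m : ℕ} (k : Fin m) : Measurable fun w : Fin m → ℝ => eps w k := by
  unfold eps
  refine Finset.measurable_prod _ fun l _ => ?_
  split_ifs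
  · exact measurable_const
  · exact measurable_sgn.comp ((measurable_pi_apply k).sub (measurable_pi_apply l))

theorem abs_eps_le_one {m : ℕ} (w : Fin m → ℝ) (k : Fin m) : |eps w k| ≤ 1 := by
  rw [eps, Finset.abs_prod]
  refine Finset.prod_le_one (fun _ _ => abs_nonneg _) fun l _ => ?_
  split_ifs
  · simp
  · exact abs_sgn_le_one _

theorem integral_leg_mul_fleg (i j : ℕ) :
    ∫ t, (leg i).eval t * (fleg j).eval t ∂seg = if i = j then 1 else 0 := by
  have h : ∀ t, (leg i).eval t * (fleg j).eval t = (2 * j + 1) / 2 * (leg i * leg j).eval t := by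
    intro t; simp only [fleg, eval_mul, eval_C]; ring
  simp only [h]
  rw [integral_seg, intervalIntegral.integral_const_mul]
  split_ifs with hij
  · rw [hij, integral_leg_mul_self]; field_simp
  · rw [integral_leg_mul_leg_of_ne hij, mul_zero]

theorem curryLeft_sum_smul (e : ℕ → V) (n : ℕ) (c : ℕ → ℝ) {m : ℕ} (Φ : V [⋀^Fin (m + 1)]→ₗ[ℝ] ℝ)
    (v : Fin m → V) : Φ.curryLeft (∑ j ∈ Finset.range n, c j • e j) v =
      ∑ j ∈ Finset.range n, c j * Φ.curryLeft (e j) v := by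
  induction n with
  | zero => simp
  | succ n ih =>
    rw [Finset.sum_range_succ, map_add, AlternatingMap.add_apply, ih, Finset.sum_range_succ,
      map_smul, AlternatingMap.smul_apply, smul_eq_mul]

/-- The curve has coordinates of index at most `n`: `P_{n+2}` is orthogonal to all of them, and
`P_n` selects the last one. -/
theorem integral_mul_curryLeft_rho (e : ℕ → V) (n : ℕ) {m : ℕ} (Φ : V [⋀^Fin (m + 1)]→ₗ[ℝ] ℝ)
    (v : Fin m → V) :
    ∫ t, ((leg n).eval t - (leg (n + 2)).eval t) * Φ (Matrix.vecCons (rho e (n + 1) t) v) ∂seg =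
      Φ.curryLeft (e n) v := by
  have h : ∀ t, ((leg n).eval t - (leg (n + 2)).eval t) * Φ (Matrix.vecCons (rho e (n + 1) t) v) =
      ∑ j ∈ Finset.range (n + 1), (((leg n).eval t * (fleg j).eval t) * Φ.curryLeft (e j) v -
        ((leg (n + 2)).eval t * (fleg j).eval t) * Φ.curryLeft (e j) v) := by
    intro t
    rw [← AlternatingMap.curryLeft_apply_apply, rho, curryLeft_sum_smul, Finset.mul_sum]
    exact Finset.sum_congr rfl fun j _ => by ring
  simp only [h]
  have hi : ∀ i j, Integrable (fun t => ((leg i).eval t * (fleg j).eval t) * Φ.curryLeft (e j) v)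
      seg := fun i j => integrable_seg
    (((leg i).continuous.mul (fleg j).continuous).mul continuous_const)
  rw [integral_finsetSum _ fun j _ => (hi n j).sub' (hi (n + 2) j)]
  simp only [integral_sub (hi _ _) (hi _ _), integral_mul_const, integral_leg_mul_fleg]
  rw [Finset.sum_eq_single n]
  · simp
  · intro j hj hne
    have := Finset.mem_range.1 hj
    rw [if_neg hne.symm, if_neg (by omega)]
    simp
  · simp

/-- By symmetry `k = 0` suffices. There `eps w 0` cancels the signs by which `w 0` enters the
Vandermonde product, so the dependence on `w 0` is polynomial and orthogonality applies. -/
theorem integral_eps (e : ℕ → V) (n : ℕ) {m : ℕ} (Φ : V [⋀^Fin (m + 1)]→ₗ[ℝ] ℝ)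
    (k : Fin (m + 1)) :
    ∫ w, sgn (vdm w) * (Φ (fun i => rho e (n + 1) (w i)) *
      (eps w k * ((leg n).eval (w k) - (leg (n + 2)).eval (w k)))) ∂cube (m + 1) =
    pf e (n + 1) (Φ.curryLeft (e n)) := by
  rw [← integral_cube_comp_perm (Equiv.swap 0 k)]
  have h1 : ∀ w : Fin (m + 1) → ℝ, sgn (vdm (w ∘ Equiv.swap 0 k)) *
      (Φ (fun i => rho e (n + 1) ((w ∘ Equiv.swap 0 k) i)) * (eps (w ∘ Equiv.swap 0 k) k *
        ((leg n).eval ((w ∘ Equiv.swap 0 k) k) - (leg (n + 2)).eval ((w ∘ Equiv.swap 0 k) k)))) =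
      (sgn (vdm w) * eps w 0) * (Φ (fun i => rho e (n + 1) (w i)) *
        ((leg n).eval (w 0) - (leg (n + 2)).eval (w 0))) := by
    intro w
    rw [show (fun i => rho e (n + 1) ((w ∘ Equiv.swap 0 k) i)) =
      (fun i => rho e (n + 1) (w i)) ∘ Equiv.swap 0 k from rfl, Φ.map_perm, vdm_comp_perm,
      eps_comp_perm, sgn_mul, sgn_sign]
    simp only [Function.comp_apply, Equiv.swap_apply_right]
    rcases Int.units_eq_one_or (Equiv.Perm.sign (Equiv.swap 0 k)) with h | h <;> simp [h] <;> ring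
  simp only [h1]
  rw [integral_cube_succ, pf]
  · refine integral_congr_ae (Filter.Eventually.of_forall fun w => ?_)
    simp only [← integral_mul_curryLeft_rho]
    rw [← integral_const_mul]
    refine integral_congr_ae ?_
    filter_upwards [ae_ne_seg w] with t ht
    simp only [comp_vecCons (rho e (n + 1)), vdm_vecCons, eps_zero, Matrix.cons_val_zero,
      Matrix.cons_val_succ, sgn_mul, sgn_prod]
    have : (∏ j, sgn (t - w j)) * ∏ j, sgn (t - w j) = 1 := by
      rw [← Finset.prod_mul_distrib]
      exact Finset.prod_eq_one fun j _ => sgn_mul_self (sub_ne_zero.2 (ht j))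
    linear_combination (sgn (vdm w) * (Φ (Matrix.vecCons (rho e (n + 1) t)
      fun i => rho e (n + 1) (w i)) * ((leg n).eval t - (leg (n + 2)).eval t))) * this
  · refine integrable_mul_of_abs_le_one ((measurable_sgn_vdm _).mul (measurable_eps 0)) ?_ ?_
    · intro x
      rw [abs_mul]
      exact mul_le_one₀ (abs_sgn_le_one _) (abs_nonneg _) (abs_eps_le_one _ _)
    · refine integrable_cube ((continuous_rho e _ Φ).mul ?_)
      exact ((leg n).continuous.comp (continuous_apply 0)).sub
        ((leg (n + 2)).continuous.comp (continuous_apply 0))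

/-- The recursion for the integrals of alternating forms along the Legendre curve. -/
theorem pf_add_two (e : ℕ → V) (n : ℕ) {m : ℕ} (Φ : V [⋀^Fin (m + 2)]→ₗ[ℝ] ℝ) :
    pf e (n + 2) Φ = pf e (n + 1) Φ +
      (m + 2) * (m + 1) * pf e n ((Φ.curryLeft (e (n + 1))).curryLeft (e n)) := by
  -- `integral_eps` produces the curve with components up to `e n`. Since `e n` already fills a
  -- slot, its component may be added to the shorter curve of the claim.
  rw [pf_succ_succ, ← pf_curryLeft_succ]
  set Ψ := Φ.curryLeft (e (n + 1))
  have h : ∀ᵐ w ∂cube (m + 1), sgn (vdm w) * (Ψ (fun i => rho e (n + 1) (w i)) *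
      ∫ t, (∏ j, sgn (t - w j)) * (fleg (n + 1)).eval t ∂seg) =
      ∑ k, sgn (vdm w) * (Ψ (fun i => rho e (n + 1) (w i)) *
        (eps w k * ((leg n).eval (w k) - (leg (n + 2)).eval (w k)))) := by
    filter_upwards [ae_injective_cube (m + 1), ae_mem_cube (m + 1)] with w h1 h2
    rw [integral_prod_sgn_mul_fleg n h1 h2, Finset.mul_sum, Finset.mul_sum]
  rw [integral_congr_ae h, integral_finsetSum]
  · simp only [integral_eps]
    rw [Finset.sum_const, Finset.card_univ, Fintype.card_fin, nsmul_eq_mul]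
    push_cast
    ring
  · intro k _
    refine integrable_mul_of_abs_le_one (measurable_sgn_vdm _) (fun _ => abs_sgn_le_one _) ?_
    have : ∀ w : Fin (m + 1) → ℝ, Ψ (fun i => rho e (n + 1) (w i)) *
        (eps w k * ((leg n).eval (w k) - (leg (n + 2)).eval (w k))) =
        eps w k * (Ψ (fun i => rho e (n + 1) (w i)) *
          ((leg n).eval (w k) - (leg (n + 2)).eval (w k))) := fun w => by ring
    simp only [this]
    refine integrable_mul_of_abs_le_one (measurable_eps k) (fun _ => abs_eps_le_one _ _) ?_
    refine integrable_cube ((continuous_rho e _ Ψ).mul ?_)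
    exact ((leg n).continuous.comp (continuous_apply k)).sub
      ((leg (n + 2)).continuous.comp (continuous_apply k))

/-! ### Evaluation of the integrals with zero, one or two free arguments -/

/-- Linear combinations of the first `n` vectors of `e`. -/
def comb (e : ℕ → V) (n : ℕ) (c : ℕ → ℝ) : V := ∑ j ∈ Finset.range n, c j • e j

theorem comb_succ (e : ℕ → V) (n : ℕ) (c : ℕ → ℝ) :
    comb e (n + 1) c = comb e n c + c n • e n := Finset.sum_range_succ _ _

theorem map_comb_eq_zero (e : ℕ → V) {m k : ℕ} (h : k < m) (Φ : V [⋀^Fin m]→ₗ[ℝ] ℝ)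
    (a : Fin m → ℕ → ℝ) : Φ (fun i => comb e k (a i)) = 0 := by
  have h1 := Φ.toMultilinearMap.map_sum_finset (fun i j => a i j • e j) (fun _ => Finset.range k)
  refine h1.trans (Finset.sum_eq_zero fun r hr => ?_)
  refine (Φ.toMultilinearMap.map_smul_univ _ _).trans ?_
  have hr' := Fintype.mem_piFinset.1 hr
  obtain ⟨i, -, j, -, hij, heq⟩ := Finset.exists_ne_map_eq_of_card_lt_of_maps_to
    (s := (Finset.univ : Finset (Fin m))) (t := Finset.range k) (f := r) (by simpa using h)
    (fun i _ => hr' i)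
  have : Φ (fun i => e (r i)) = 0 := Φ.map_eq_zero_of_eq _ (by rw [heq]) hij
  rw [smul_eq_mul]
  exact mul_eq_zero_of_right _ this

theorem curryLeft_swap {R M : Type*} [CommRing R] [AddCommGroup M] [Module R M] {m : ℕ}
    (Φ : M [⋀^Fin (m + 2)]→ₗ[R] R) (u v : M) :
    (Φ.curryLeft u).curryLeft v = -(Φ.curryLeft v).curryLeft u := by
  have h := AlternatingMap.curryLeft_same Φ (u + v)
  simp only [map_add, AlternatingMap.curryLeft_add, LinearMap.add_apply,
    AlternatingMap.curryLeft_same, zero_add, add_zero] at h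
  rw [eq_neg_iff_add_eq_zero, add_comm]
  exact h

/-- A cyclic permutation of three arguments is even. -/
theorem curryLeft_rotate {m : ℕ} (Φ : V [⋀^Fin (m + 3)]→ₗ[ℝ] ℝ) (c a b : V) :
    ((Φ.curryLeft c).curryLeft a).curryLeft b = ((Φ.curryLeft a).curryLeft b).curryLeft c := by
  rw [curryLeft_swap Φ c a]
  ext v
  have h := curryLeft_swap (Φ.curryLeft a) c b
  have h' := congrArg (fun F => F v) h
  simp only [AlternatingMap.neg_apply, AlternatingMap.curryLeft_apply_apply] at h' ⊢
  rw [h', neg_neg]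

theorem pf_add (e : ℕ → V) (n : ℕ) {m : ℕ} (Φ Ψ : V [⋀^Fin m]→ₗ[ℝ] ℝ) :
    pf e n (Φ + Ψ) = pf e n Φ + pf e n Ψ := by
  have hi : ∀ Φ : V [⋀^Fin m]→ₗ[ℝ] ℝ,
      Integrable (fun x => sgn (vdm x) * Φ (fun i => rho e n (x i))) (cube m) := fun Φ =>
    integrable_mul_of_abs_le_one (measurable_sgn_vdm _) (fun _ => abs_sgn_le_one _)
      (integrable_cube (continuous_rho e n Φ))
  simp only [pf, AlternatingMap.add_apply, mul_add]
  exact integral_add (hi Φ) (hi Ψ)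

theorem pf_smul (e : ℕ → V) (n : ℕ) {m : ℕ} (c : ℝ) (Φ : V [⋀^Fin m]→ₗ[ℝ] ℝ) :
    pf e n (c • Φ) = c * pf e n Φ := by
  simp only [pf, AlternatingMap.smul_apply, smul_eq_mul, mul_left_comm _ c]
  exact integral_const_mul _ _

theorem pf_eq_zero (e : ℕ → V) {n m : ℕ} (h : n < m) (Φ : V [⋀^Fin m]→ₗ[ℝ] ℝ) :
    pf e n Φ = 0 := by
  have : ∀ x : Fin m → ℝ, Φ (fun i => rho e n (x i)) = 0 := fun x => map_comb_eq_zero e h Φ _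
  simp [pf, this]

theorem integral_cube_zero (f : (Fin 0 → ℝ) → ℝ) : ∫ x, f x ∂cube 0 = f ![] := by
  rw [cube, Measure.pi_of_empty (fun _ : Fin 0 => seg) ![], integral_dirac]

theorem pf_zero (e : ℕ → V) (n : ℕ) (Φ : V [⋀^Fin 0]→ₗ[ℝ] ℝ) : pf e n Φ = Φ ![] := by
  rw [pf, integral_cube_zero]
  simp only [vdm, Finset.univ_eq_empty, Finset.prod_empty, sgn_one, one_mul]
  congr 1
  ext i; exact i.elim0

/-- The integral of the curve itself: `fleg 0` has integral `1`, all later coordinates have integral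
`0`. -/
theorem pf_one (e : ℕ → V) (n : ℕ) (Φ : V [⋀^Fin 1]→ₗ[ℝ] ℝ) : pf e (n + 1) Φ = Φ ![e 0] := by
  induction n with
  | zero =>
    rw [pf_succ_succ, pf_eq_zero e (by norm_num), integral_cube_zero]
    have h0 : ∫ t, (fleg 0).eval t ∂seg = 1 := by
      rw [integral_seg]
      simp only [fleg, leg_zero, mul_one, eval_C, intervalIntegral.integral_const]
      norm_num
    have h1 : (fun i => rho e 0 ((![] : Fin 0 → ℝ) i)) = ![] := Subsingleton.elim _ _
    rw [h1]
    simp [vdm, sgn_one, h0]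
  | succ n ih =>
    rw [pf_succ_succ, ih, integral_cube_zero]
    have : ∫ t, (fleg (n + 1)).eval t ∂seg = 0 := by
      rw [integral_seg, integral_fleg_succ, eval_one_leg, eval_one_leg, eval_neg_one_leg,
        eval_neg_one_leg]
      ring
    simp [this]

/-- The vectors `e (n - 1), …, e 0`. -/
def revv {α : Type*} (e : ℕ → α) (n : ℕ) : Fin n → α := fun i => e (n - 1 - i)

theorem revv_succ {α : Type*} (e : ℕ → α) (n : ℕ) : revv e (n + 1) = Matrix.vecCons (e n) (revv e n) := by
  ext i
  cases i using Fin.cases with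
  | zero => simp [revv]
  | succ i => simp [revv]; congr 1; omega

theorem revv_zero {α : Type*} (e : ℕ → α) : revv e 0 = ![] := by ext i; exact i.elim0

theorem map_vecCons_comb_revv (e : ℕ → V) (n : ℕ) (c : ℕ → ℝ) (Φ : V [⋀^Fin (n + 1)]→ₗ[ℝ] ℝ) :
    Φ (Matrix.vecCons (comb e (n + 1) c) (revv e n)) = c n * Φ (revv e (n + 1)) := by
  rw [revv_succ, ← AlternatingMap.curryLeft_apply_apply, comb, curryLeft_sum_smul,
    Finset.sum_range_succ, AlternatingMap.curryLeft_apply_apply, add_eq_right]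
  refine Finset.sum_eq_zero fun j hj => mul_eq_zero_of_right _ ?_
  have hj' := Finset.mem_range.1 hj
  rw [AlternatingMap.curryLeft_apply_apply]
  refine Φ.map_eq_zero_of_eq _ (i := 0) (j := Fin.succ ⟨n - 1 - j, by omega⟩) ?_
    (Fin.succ_ne_zero _).symm
  simp only [Matrix.cons_val_zero, Matrix.cons_val_succ, revv]
  congr 1; omega

/-- In `pf_add_two` the shorter curve spans too small a space for `n + 2` arguments, so only the
curried term survives; the factors `(n + 2) (n + 1)` build up the factorial. -/
theorem pf_self (e : ℕ → V) (n : ℕ) (Φ : V [⋀^Fin n]→ₗ[ℝ] ℝ) :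
    pf e n Φ = n.factorial * Φ (revv e n) := by
  induction n using Nat.twoStepInduction with
  | zero => rw [pf_zero, revv_zero]; simp
  | one =>
    rw [pf_one, revv_succ, revv_zero]; simp
  | more n ih _ =>
    rw [pf_add_two, pf_eq_zero e (by omega), ih, AlternatingMap.curryLeft_apply_apply,
      AlternatingMap.curryLeft_apply_apply, ← revv_succ, ← revv_succ, Nat.factorial_succ,
      Nat.factorial_succ]
    push_cast
    ring

/-- The sum `c n + c (n - 2) + ⋯`. -/
def altSum (c : ℕ → ℝ) : ℕ → ℝ
  | 0 => c 0
  | 1 => c 1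
  | n + 2 => c (n + 2) + altSum c n

theorem curryLeft_curryLeft_comb (e : ℕ → V) (n : ℕ) (c : ℕ → ℝ) {m : ℕ}
    (Φ : V [⋀^Fin (m + 3)]→ₗ[ℝ] ℝ) :
    ((Φ.curryLeft (e (n + 1))).curryLeft (e n)).curryLeft (comb e (n + 2) c) =
      ((Φ.curryLeft (e (n + 1))).curryLeft (e n)).curryLeft (comb e n c) := by
  have h : ((Φ.curryLeft (e (n + 1))).curryLeft (e n)).curryLeft (e (n + 1)) = 0 := by
    rw [← curryLeft_rotate, AlternatingMap.curryLeft_same, AlternatingMap.curryLeft_zero]; rfl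
  rw [comb_succ, comb_succ, map_add, map_add, map_smul, map_smul, h,
    AlternatingMap.curryLeft_same]
  simp

/-- In the recursion the shorter curve fills all dimensions but the top one, which the free argument
must supply with its last coefficient. The curried term ignores the two top coefficients, and the
induction continues two indices lower. -/
theorem pf_curryLeft_comb (e : ℕ → V) (n : ℕ) (c : ℕ → ℝ) (Φ : V [⋀^Fin (n + 1)]→ₗ[ℝ] ℝ) :
    pf e (n + 1) (Φ.curryLeft (comb e (n + 1) c)) =
      n.factorial * (altSum c n * Φ (revv e (n + 1))) := by
  induction n using Nat.twoStepInduction with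
  | zero =>
    rw [pf_zero, AlternatingMap.curryLeft_apply_apply, ← revv_zero e, map_vecCons_comb_revv]
    simp [altSum]
  | one =>
    rw [pf_one, AlternatingMap.curryLeft_apply_apply, show ![e 0] = revv e 1 by
      rw [revv_succ, revv_zero], map_vecCons_comb_revv]
    simp [altSum]
  | more n ih _ =>
    rw [pf_add_two, pf_self, AlternatingMap.curryLeft_apply_apply, map_vecCons_comb_revv,
      curryLeft_rotate, curryLeft_curryLeft_comb, ih, AlternatingMap.curryLeft_apply_apply,
      AlternatingMap.curryLeft_apply_apply, ← revv_succ, ← revv_succ, altSum, Nat.factorial_succ,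
      Nat.factorial_succ]
    push_cast
    ring

/-- The bilinear expression through which an alternating form depends on two arguments once the
others are integrated along the Legendre curve. -/
def altPair (c c' : ℕ → ℝ) : ℕ → ℝ
  | 0 => c 1 * altSum c' 0 - c' 1 * altSum c 0
  | 1 => c 2 * altSum c' 1 - c' 2 * altSum c 1
  | n + 2 => altPair c c' n + (c (n + 3) * altSum c' (n + 2) - c' (n + 3) * altSum c (n + 2))

theorem curryLeft_comb_succ_comb_succ (e : ℕ → V) (n : ℕ) (c c' : ℕ → ℝ) {m : ℕ}
    (Φ : V [⋀^Fin (m + 2)]→ₗ[ℝ] ℝ) :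
    (Φ.curryLeft (comb e (n + 1) c)).curryLeft (comb e (n + 1) c') =
      (Φ.curryLeft (comb e n c)).curryLeft (comb e n c') +
      (c n • (Φ.curryLeft (e n)).curryLeft (comb e n c') +
        (-c' n) • (Φ.curryLeft (e n)).curryLeft (comb e n c)) := by
  rw [comb_succ, comb_succ]
  simp only [map_add, map_smul, AlternatingMap.curryLeft_add, AlternatingMap.curryLeft_smul,
    LinearMap.add_apply, LinearMap.smul_apply, AlternatingMap.curryLeft_same]
  rw [curryLeft_swap Φ (comb e n c) (e n)]
  module

theorem pf_comb_comb_eq_zero (e : ℕ → V) {n m : ℕ} (h : n ≤ m + 1) (c c' : ℕ → ℝ)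
    (Φ : V [⋀^Fin (m + 2)]→ₗ[ℝ] ℝ) :
    pf e n ((Φ.curryLeft (comb e n c)).curryLeft (comb e n c')) = 0 := by
  have : ∀ x : Fin m → ℝ, (Φ.curryLeft (comb e n c)).curryLeft (comb e n c')
      (fun i => rho e n (x i)) = 0 := by
    intro x
    rw [AlternatingMap.curryLeft_apply_apply, AlternatingMap.curryLeft_apply_apply]
    have := map_comb_eq_zero e (by omega : n < m + 2) Φ
      (Matrix.vecCons c (Matrix.vecCons c' fun i j => (fleg j).eval (x i)))
    rw [comp_vecCons (comb e n), comp_vecCons (comb e n)] at this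
    exact this
  simp [pf, this]

/-- The curve lacks `e (n + 1)`, so exactly one free argument must supply it; the other one then
falls under `pf_curryLeft_comb`. -/
theorem pf_comb_comb_aux (e : ℕ → V) (n : ℕ) (c c' : ℕ → ℝ) (Φ : V [⋀^Fin (n + 2)]→ₗ[ℝ] ℝ) :
    pf e (n + 1) ((Φ.curryLeft (comb e (n + 2) c)).curryLeft (comb e (n + 2) c')) =
      n.factorial * ((c (n + 1) * altSum c' n - c' (n + 1) * altSum c n) *
        Φ (revv e (n + 2))) := by
  rw [curryLeft_comb_succ_comb_succ, pf_add, pf_add, pf_smul, pf_smul,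
    pf_comb_comb_eq_zero e le_rfl, pf_curryLeft_comb, pf_curryLeft_comb,
    AlternatingMap.curryLeft_apply_apply, ← revv_succ]
  ring

theorem pf_curryLeft_comb_comb (e : ℕ → V) (n : ℕ) (c c' : ℕ → ℝ)
    (Φ : V [⋀^Fin (n + 2)]→ₗ[ℝ] ℝ) :
    pf e (n + 2) ((Φ.curryLeft (comb e (n + 2) c)).curryLeft (comb e (n + 2) c')) =
      n.factorial * (altPair c c' n * Φ (revv e (n + 2))) := by
  induction n using Nat.twoStepInduction with
  | zero =>
    -- With zero slots, and in the next case one slot, left for the curve, lengthening it from `n +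
    -- 1` to `n + 2` components does not change the integral.
    have := pf_comb_comb_aux e 0 c c' Φ
    rw [pf_zero] at this ⊢
    exact this
  | one =>
    have := pf_comb_comb_aux e 1 c c' Φ
    rw [pf_one] at this ⊢
    exact this
  | more n ih _ =>
    have h : (((Φ.curryLeft (comb e (n + 4) c)).curryLeft (comb e (n + 4) c')).curryLeft
        (e (n + 3))).curryLeft (e (n + 2)) =
        (((Φ.curryLeft (e (n + 3))).curryLeft (e (n + 2))).curryLeft (comb e (n + 2) c)).curryLeft
          (comb e (n + 2) c') := by
      rw [curryLeft_rotate (Φ.curryLeft _), curryLeft_rotate Φ, curryLeft_curryLeft_comb,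
        curryLeft_swap _ (comb e (n + 2) c), curryLeft_curryLeft_comb, curryLeft_swap, neg_neg]
    rw [pf_add_two, pf_comb_comb_aux, h, ih, AlternatingMap.curryLeft_apply_apply,
      AlternatingMap.curryLeft_apply_apply, ← revv_succ, ← revv_succ, altPair,
      Nat.factorial_succ, Nat.factorial_succ]
    push_cast
    ring

/-! ### The addition formula -/

section Addition

open MvPolynomial (pderiv)

local notation "𝓡" => MvPolynomial (Fin 2) ℝ

/-- The Legendre operator in the variable `i`. -/
noncomputable def lop (i : Fin 2) (F : 𝓡) : 𝓡 :=
  pderiv i ((MvPolynomial.X i ^ 2 - 1) * pderiv i F)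

theorem lop_add (i : Fin 2) (F G : 𝓡) : lop i (F + G) = lop i F + lop i G := by
  simp [lop, mul_add]

theorem lop_sub (i : Fin 2) (F G : 𝓡) : lop i (F - G) = lop i F - lop i G := by
  simp [lop, mul_sub]

theorem lop_smul (i : Fin 2) (c : ℝ) (F : 𝓡) : lop i (c • F) = c • lop i F := by
  simp [lop]

theorem derivation_ofNat_two (D : Derivation ℝ 𝓡 𝓡) : D 2 = 0 := by
  have := D.map_natCast 2
  exact_mod_cast this

/-- An abstract derivation allows the same computation to serve both partial derivatives, with the
roles of `x` and `y` exchanged. -/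
theorem derivation_legendre_aeval_mul_pow (D : Derivation ℝ 𝓡 𝓡) {x y : 𝓡} (hx : D x = 1)
    (hy : D y = 0) (q : ℝ[X]) (k : ℕ) :
    D ((x ^ 2 - 1) * D (aeval (x * y) q * ((x ^ 2 - 1) * (y ^ 2 - 1)) ^ (k + 1))) =
      (2 * (k + 2) * x * y * aeval (x * y) (derivative q) + 2 * (k + 1) * aeval (x * y) q +
        (x ^ 2 - 1) * y ^ 2 * aeval (x * y) (derivative (derivative q))) *
          ((x ^ 2 - 1) * (y ^ 2 - 1)) ^ (k + 1) +
      ((x ^ 2 - 1) * y * aeval (x * y) (derivative q) + 2 * (k + 1) * x * aeval (x * y) q) *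
        (2 * (k + 1) * x * (y ^ 2 - 1) * ((x ^ 2 - 1) * (y ^ 2 - 1)) ^ k) := by
  have h1 : ∀ q : ℝ[X], D (aeval (x * y) q) = aeval (x * y) (derivative q) * y := by
    intro q
    simp only [Derivation.map_aeval, Derivation.leibniz, hx, hy, smul_eq_mul]
    ring
  have hu : D (x ^ 2 - 1) = 2 * x := by
    simp only [pow_two, map_sub, Derivation.leibniz, hx, smul_eq_mul, Derivation.map_one_eq_zero]
    ring
  have hv : D (y ^ 2 - 1) = 0 := by
    simp only [pow_two, map_sub, Derivation.leibniz, hy, smul_eq_mul, Derivation.map_one_eq_zero]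
    ring
  have hW : D (((x ^ 2 - 1) * (y ^ 2 - 1)) ^ (k + 1)) =
      2 * (k + 1) * x * (y ^ 2 - 1) * ((x ^ 2 - 1) * (y ^ 2 - 1)) ^ k := by
    rw [Derivation.leibniz_pow, Derivation.leibniz, hu, hv]
    simp only [smul_eq_mul, nsmul_eq_mul, Nat.add_sub_cancel]
    push_cast
    ring
  have hk : D ((k : 𝓡)) = 0 := D.map_natCast k
  have e : (x ^ 2 - 1) * D (aeval (x * y) q * ((x ^ 2 - 1) * (y ^ 2 - 1)) ^ (k + 1)) =
      ((x ^ 2 - 1) * (y * aeval (x * y) (derivative q)) + 2 * ((k + 1) * (x * aeval (x * y) q))) *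
        ((x ^ 2 - 1) * (y ^ 2 - 1)) ^ (k + 1) := by
    rw [Derivation.leibniz, hW, h1]
    simp only [smul_eq_mul]
    ring
  rw [e, Derivation.leibniz, hW]
  simp only [map_add, Derivation.leibniz, h1, hu, hx, hy, hk, derivation_ofNat_two,
    Derivation.map_one_eq_zero, smul_eq_mul]
  ring

theorem derivation_legendre_aeval (D : Derivation ℝ 𝓡 𝓡) {x y : 𝓡} (hx : D x = 1)
    (hy : D y = 0) (q : ℝ[X]) :
    D ((x ^ 2 - 1) * D (aeval (x * y) q)) =
      2 * x * y * aeval (x * y) (derivative q) +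
        (x ^ 2 - 1) * y ^ 2 * aeval (x * y) (derivative (derivative q)) := by
  simp only [pow_two, map_sub, Derivation.map_aeval, Derivation.leibniz, hx, hy, smul_eq_mul,
    Derivation.map_one_eq_zero, map_zero, map_add]
  ring

theorem pderiv_zero_X_zero : pderiv 0 (MvPolynomial.X 0 : 𝓡) = 1 := by simp

theorem pderiv_one_X_one : pderiv 1 (MvPolynomial.X 1 : 𝓡) = 1 := by simp

theorem pderiv_zero_X_one : pderiv 0 (MvPolynomial.X 1 : 𝓡) = 0 := by
  simp [MvPolynomial.pderiv_X]

theorem pderiv_one_X_zero : pderiv 1 (MvPolynomial.X 0 : 𝓡) = 0 := by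
  simp [MvPolynomial.pderiv_X]

/-- One resulting term raises the order of differentiation by two and the other lowers the power by
one, so that consecutive summands of `addPoly` can cancel. -/
theorem lop_aeval_mul_pow (q : ℝ[X]) (k : ℕ) :
    let x : 𝓡 := MvPolynomial.X 0
    let y : 𝓡 := MvPolynomial.X 1
    lop 0 (aeval (x * y) q * ((x ^ 2 - 1) * (y ^ 2 - 1)) ^ (k + 1)) -
      lop 1 (aeval (x * y) q * ((x ^ 2 - 1) * (y ^ 2 - 1)) ^ (k + 1)) =
    (x ^ 2 - y ^ 2) * (aeval (x * y) (derivative (derivative q)) *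
      ((x ^ 2 - 1) * (y ^ 2 - 1)) ^ (k + 1) -
      4 * (k + 1) ^ 2 * (aeval (x * y) q * ((x ^ 2 - 1) * (y ^ 2 - 1)) ^ k)) := by
  intro x y
  have h0 := derivation_legendre_aeval_mul_pow (pderiv 0) pderiv_zero_X_zero pderiv_zero_X_one q k
  have h1 := derivation_legendre_aeval_mul_pow (pderiv 1) pderiv_one_X_one pderiv_one_X_zero q k
  rw [mul_comm (MvPolynomial.X 1 : 𝓡) (MvPolynomial.X 0),
    mul_comm (MvPolynomial.X 1 ^ 2 - 1 : 𝓡) (MvPolynomial.X 0 ^ 2 - 1)] at h1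
  simp only [lop]
  rw [h0, h1]
  ring

theorem lop_aeval (q : ℝ[X]) :
    let x : 𝓡 := MvPolynomial.X 0
    let y : 𝓡 := MvPolynomial.X 1
    lop 0 (aeval (x * y) q) - lop 1 (aeval (x * y) q) =
    (x ^ 2 - y ^ 2) * aeval (x * y) (derivative (derivative q)) := by
  intro x y
  have h0 := derivation_legendre_aeval (pderiv 0) pderiv_zero_X_zero pderiv_zero_X_one q
  have h1 := derivation_legendre_aeval (pderiv 1) pderiv_one_X_one pderiv_one_X_zero q
  rw [mul_comm (MvPolynomial.X 1 : 𝓡) (MvPolynomial.X 0)] at h1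
  simp only [lop]
  rw [h0, h1]
  ring

/-- The right-hand side of the addition formula. -/
noncomputable def addPoly (p : ℝ[X]) (n : ℕ) : 𝓡 :=
  ∑ k ∈ Finset.range (n + 1), (1 / (4 ^ k * (k.factorial : ℝ) ^ 2)) •
    (aeval (MvPolynomial.X 0 * MvPolynomial.X 1 : 𝓡) (derivative^[2 * k] p) *
      ((MvPolynomial.X 0 ^ 2 - 1) * (MvPolynomial.X 1 ^ 2 - 1)) ^ k)

/-- The coefficients `1 / (4 ^ k * k! ^ 2)` are those for which the sum telescopes; what remains
contains the derivative of order `2 n + 2`, which the degree bound kills. -/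
theorem lop_addPoly (p : ℝ[X]) (n : ℕ) (hn : p.natDegree < 2 * n + 2) :
    lop 0 (addPoly p n) = lop 1 (addPoly p n) := by
  have h : ∀ n : ℕ, lop 0 (addPoly p n) - lop 1 (addPoly p n) =
      (1 / (4 ^ n * (n.factorial : ℝ) ^ 2)) • ((MvPolynomial.X 0 ^ 2 - MvPolynomial.X 1 ^ 2) *
        (aeval (MvPolynomial.X 0 * MvPolynomial.X 1 : 𝓡) (derivative^[2 * n + 2] p) *
          ((MvPolynomial.X 0 ^ 2 - 1) * (MvPolynomial.X 1 ^ 2 - 1)) ^ n)) := by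
    intro n
    induction n with
    | zero => simpa [addPoly] using lop_aeval p
    | succ n ih =>
      have hs : addPoly p (n + 1) = addPoly p n +
        (1 / (4 ^ (n + 1) * ((n + 1).factorial : ℝ) ^ 2)) •
        (aeval (MvPolynomial.X 0 * MvPolynomial.X 1 : 𝓡) (derivative^[2 * (n + 1)] p) *
          ((MvPolynomial.X 0 ^ 2 - 1) * (MvPolynomial.X 1 ^ 2 - 1)) ^ (n + 1)) :=
        Finset.sum_range_succ _ _
      have ht := lop_aeval_mul_pow (derivative^[2 * (n + 1)] p) n
      have hc : (1 / (4 ^ n * (n.factorial : ℝ) ^ 2)) =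
          (1 / (4 ^ (n + 1) * ((n + 1).factorial : ℝ) ^ 2)) * (4 * (n + 1) ^ 2) := by
        rw [Nat.factorial_succ, pow_succ]
        push_cast
        have : (n.factorial : ℝ) ≠ 0 := by positivity
        field_simp
        try ring
      rw [hs, lop_add, lop_add, lop_smul, lop_smul, add_sub_add_comm, ih, ← smul_sub, ht, hc,
        mul_smul, ← smul_add]
      congr 1
      rw [show derivative^[2 * (n + 1) + 2] p = derivative (derivative (derivative^[2 * (n + 1)] p))
        by rw [Function.iterate_succ_apply', Function.iterate_succ_apply']]
      rw [show 2 * n + 2 = 2 * (n + 1) by ring, MvPolynomial.smul_eq_C_mul]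
      simp only [map_mul, map_pow, map_add, map_natCast, map_ofNat, map_one]
      ring
  rw [← sub_eq_zero, h n, iterate_derivative_eq_zero (by omega)]
  simp

theorem X_sub_one_dvd {F : 𝓡} (h : MvPolynomial.aeval ![(MvPolynomial.X 0 : 𝓡), 1] F = 0) :
    (MvPolynomial.X 1 - 1 : 𝓡) ∣ F := by
  have key : ∀ F : 𝓡, Ideal.Quotient.mkₐ ℝ (Ideal.span {(MvPolynomial.X 1 - 1 : 𝓡)}) F =
      Ideal.Quotient.mkₐ ℝ (Ideal.span {(MvPolynomial.X 1 - 1 : 𝓡)})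
        (MvPolynomial.aeval ![(MvPolynomial.X 0 : 𝓡), 1] F) := by
    intro F
    rw [← AlgHom.comp_apply]
    congr 1
    ext i
    fin_cases i
    · simp
    · simp only [Fin.mk_one, AlgHom.comp_apply, MvPolynomial.aeval_X]
      exact Ideal.Quotient.eq.2 (Ideal.subset_span rfl)
  have h2 := key F
  rw [h, map_zero] at h2
  exact Ideal.mem_span_singleton.1 (Ideal.Quotient.eq_zero_iff_mem.1 h2)

/-- The line `y = 1` is a singular line of the operator in `y`. If `(y - 1) ^ (k + 1)` is the exact
power dividing `F`, it still divides `lop 0 F`, whereas `lop 1 F` begins with `2 (k + 1)² (y - 1) ^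
k` times the cofactor, which forces a further factor `y - 1`. -/
theorem eq_zero_of_lop_eq {F : 𝓡} (h : lop 0 F = lop 1 F)
    (h1 : MvPolynomial.aeval ![(MvPolynomial.X 0 : 𝓡), 1] F = 0) : F = 0 := by
  by_contra hF
  set t : 𝓡 := MvPolynomial.X 1 - 1 with ht
  have ht0 : pderiv 0 t = 0 := by rw [ht, map_sub, pderiv_zero_X_one]; simp
  have ht1 : pderiv 1 t = 1 := by rw [ht, map_sub, pderiv_one_X_one]; simp
  have haev : MvPolynomial.aeval ![(MvPolynomial.X 0 : 𝓡), 1] t = 0 := by simp [ht]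
  have hu : ¬IsUnit t := by
    intro hu
    have := hu.map (MvPolynomial.aeval ![(MvPolynomial.X 0 : 𝓡), 1] : 𝓡 →ₐ[ℝ] 𝓡)
    rw [haev] at this
    exact not_isUnit_zero this
  have htne : t ≠ 0 := by
    intro h0
    rw [h0, map_zero] at ht1
    exact zero_ne_one ht1
  obtain ⟨G, hG, hnd⟩ := (FiniteMultiplicity.of_not_isUnit hu hF).exists_eq_pow_mul_and_not_dvd
  have hk : multiplicity t F ≠ 0 := by
    intro h0
    rw [h0, pow_zero, one_mul] at hG
    exact hnd (hG ▸ X_sub_one_dvd h1)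
  obtain ⟨k, hk'⟩ := Nat.exists_eq_succ_of_ne_zero hk
  rw [hk'] at hG
  apply hnd
  have e0 : lop 0 F = t ^ (k + 1) * lop 0 G := by
    rw [hG]
    simp only [lop, Derivation.leibniz, Derivation.leibniz_pow, ht0, smul_eq_mul, smul_zero,
      mul_zero, map_add, map_zero, Nat.succ_eq_add_one]
    ring
  have hy : (MvPolynomial.X 1 ^ 2 - 1 : 𝓡) = t * (t + 2) := by rw [ht]; ring
  have e1 : lop 1 F = t ^ k * (2 * (k + 1) ^ 2 * G) + t ^ (k + 1) * ((k + 1) * G +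
      (k + 1) ^ 2 * G + (k + 1) * (t + 2) * pderiv 1 G + t * pderiv 1 G +
        (t + 2) * (k + 2) * pderiv 1 G + (t + 2) * t * pderiv 1 (pderiv 1 G)) := by
    have e2 : (MvPolynomial.X 1 ^ 2 - 1 : 𝓡) * pderiv 1 F =
        (k + 1) * ((t + 2) * (t ^ (k + 1) * G)) + (t + 2) * (t ^ (k + 2) * pderiv 1 G) := by
      rw [hG, hy, Derivation.leibniz, Derivation.leibniz_pow, ht1]
      simp only [smul_eq_mul, nsmul_eq_mul, Nat.succ_eq_add_one, Nat.add_sub_cancel]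
      push_cast
      ring
    have hkk : pderiv (1 : Fin 2) ((k : 𝓡)) = 0 := (pderiv (1 : Fin 2)).map_natCast k
    rw [lop, e2]
    simp only [map_add, Derivation.leibniz, Derivation.leibniz_pow, ht1, hkk, smul_eq_mul,
      derivation_ofNat_two, Derivation.map_one_eq_zero, nsmul_eq_mul, Nat.add_sub_cancel,
      show k + 2 - 1 = k + 1 from rfl]
    push_cast
    ring
  rw [e0, e1, pow_succ, ← sub_eq_iff_eq_add, mul_assoc, mul_assoc, ← mul_sub, ← mul_sub] at h
  have h3 : t ∣ 2 * (k + 1) ^ 2 * G := ⟨_, (mul_left_cancel₀ (pow_ne_zero k htne) h).symm⟩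
  have h4 : (2 * (k + 1) ^ 2 * G : 𝓡) = MvPolynomial.C (2 * (k + 1) ^ 2 : ℝ) * G := by
    simp only [map_mul, map_pow, map_add, map_natCast, map_one, map_ofNat]
  rw [h4] at h3
  have hunit : IsUnit (MvPolynomial.C (2 * (k + 1) ^ 2 : ℝ) : 𝓡) :=
    (IsUnit.mk0 _ (by positivity)).map MvPolynomial.C
  exact (hunit.dvd_mul_left).1 h3

/-- The product on the right is an eigenfunction of both Legendre operators with the same
eigenvalue, and at `y = 1` only the summand `k = 0` survives on the left. Uniqueness is
`eq_zero_of_lop_eq`. -/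
theorem addPoly_eq (n : ℕ) : addPoly (leg n) n =
    aeval (MvPolynomial.X 0 : 𝓡) (leg n) * aeval (MvPolynomial.X 1 : 𝓡) (leg n) := by
  rw [← sub_eq_zero]
  apply eq_zero_of_lop_eq
  · have hD : ∀ i : Fin 2, pderiv i ((MvPolynomial.X i ^ 2 - 1) * (pderiv i)
        (aeval (MvPolynomial.X i : 𝓡) (leg n))) =
        MvPolynomial.C (n * (n + 1) : ℝ) * aeval (MvPolynomial.X i : 𝓡) (leg n) := by
      intro i
      have e : ∀ q : ℝ[X], pderiv i (aeval (MvPolynomial.X i : 𝓡) q) =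
          aeval (MvPolynomial.X i : 𝓡) (derivative q) := by
        intro q
        rw [Derivation.map_aeval, MvPolynomial.pderiv_X_self, smul_eq_mul, mul_one]
      have := congrArg (aeval (MvPolynomial.X i : 𝓡)) (legendre_ode n)
      rw [← e, map_mul (aeval (MvPolynomial.X i : 𝓡)), map_mul (aeval (MvPolynomial.X i : 𝓡)), ← e,
        map_sub, map_pow, aeval_X, map_one, aeval_C] at this
      exact this
    have h01 : pderiv 0 (aeval (MvPolynomial.X 1 : 𝓡) (leg n)) = 0 := by
      rw [Derivation.map_aeval, pderiv_zero_X_one, smul_zero]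
    have h10 : pderiv 1 (aeval (MvPolynomial.X 0 : 𝓡) (leg n)) = 0 := by
      rw [Derivation.map_aeval, pderiv_one_X_zero, smul_zero]
    rw [lop_sub, lop_sub, lop_addPoly _ _ (by have := natDegree_leg_le n; omega)]
    congr 1
    have e0 : lop 0 (aeval (MvPolynomial.X 0 : 𝓡) (leg n) * aeval (MvPolynomial.X 1 : 𝓡) (leg n)) =
        pderiv 0 ((MvPolynomial.X 0 ^ 2 - 1) * (pderiv 0)
        (aeval (MvPolynomial.X 0 : 𝓡) (leg n))) * aeval (MvPolynomial.X 1 : 𝓡) (leg n) := by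
      simp only [lop, Derivation.leibniz, h01, smul_eq_mul, mul_zero, zero_add]
      ring
    have e1 : lop 1 (aeval (MvPolynomial.X 0 : 𝓡) (leg n) * aeval (MvPolynomial.X 1 : 𝓡) (leg n)) =
        pderiv 1 ((MvPolynomial.X 1 ^ 2 - 1) * (pderiv 1)
        (aeval (MvPolynomial.X 1 : 𝓡) (leg n))) * aeval (MvPolynomial.X 0 : 𝓡) (leg n) := by
      simp only [lop, Derivation.leibniz, h10, smul_eq_mul, mul_zero, add_zero]
      ring
    rw [e0, e1, hD, hD]
    ring
  · rw [map_sub, map_mul, ← aeval_algHom_apply, ← aeval_algHom_apply, addPoly, map_sum,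
      Finset.sum_eq_single 0]
    · rw [map_smul, map_mul, ← aeval_algHom_apply]
      simp only [map_mul, MvPolynomial.aeval_X]
      have : aeval (1 : 𝓡) (leg n) = 1 := by
        have := aeval_algebraMap_apply 𝓡 (1 : ℝ) (leg n)
        rw [map_one] at this
        rw [this, coe_aeval_eq_eval, eval_one_leg, map_one]
      simp [this]
    · intro k _ hk
      rw [map_smul, map_mul, map_pow, map_mul]
      simp [hk]
    · simp

end Addition

/-- The addition formula for Legendre polynomials on the unit circle. -/
theorem normSq_aeval_leg (n : ℕ) {z : ℂ} (hz : Complex.normSq z = 1) :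
    Complex.normSq (aeval z (leg n)) = ∑ k ∈ Finset.range (n + 1),
      (derivative^[2 * k] (leg n)).eval 1 / (k.factorial : ℝ) ^ 2 * (1 - z.re ^ 2) ^ k := by
  have hzz : z * (starRingEnd ℂ) z = 1 := by rw [Complex.mul_conj, hz]; simp
  have h := congrArg (MvPolynomial.aeval ![z, (starRingEnd ℂ) z]) (addPoly_eq n)
  rw [map_mul, ← aeval_algHom_apply, ← aeval_algHom_apply, addPoly, map_sum] at h
  simp only [map_smul, map_mul, ← aeval_algHom_apply, MvPolynomial.aeval_X, map_pow, map_sub,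
    map_one, Matrix.cons_val_zero, Matrix.cons_val_one, hzz] at h
  have hc : aeval ((starRingEnd ℂ) z) (leg n) = (starRingEnd ℂ) (aeval z (leg n)) :=
    aeval_conj _ _
  rw [hc, Complex.mul_conj] at h
  -- The formula is used at `(z, conj z)`, whose product is `1`; this factor `4` absorbs the `4 ^ k`
  -- in the coefficients.
  have hq : (z ^ 2 - 1) * ((starRingEnd ℂ) z ^ 2 - 1) = ((4 * (1 - z.re ^ 2) : ℝ) : ℂ) := by
    have h1 : (z.re : ℂ) = (z + (starRingEnd ℂ) z) / 2 := Complex.re_eq_add_conj z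
    push_cast
    rw [h1]
    linear_combination (z * (starRingEnd ℂ) z + 3) * hzz
  have h1 : ∀ q : ℝ[X], aeval (1 : ℂ) q = ((q.eval 1 : ℝ) : ℂ) := by
    intro q
    have := aeval_algebraMap_apply ℂ (1 : ℝ) q
    rw [map_one] at this
    rw [this, coe_aeval_eq_eval]; rfl
  simp only [hq, h1] at h
  rw [← Complex.ofReal_inj, ← h]
  push_cast
  refine Finset.sum_congr rfl fun k _ => ?_
  rw [mul_pow, Complex.real_smul]
  push_cast
  have : ((k.factorial : ℂ)) ≠ 0 := by exact_mod_cast k.factorial_ne_zero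
  field_simp

/-! ### The integral of `|P_n|²` over the unit semicircle -/

theorem integral_one_sub_sq_pow (k : ℕ) : ∫ x in (-1 : ℝ)..1, (1 - x ^ 2) ^ k =
    2 * 4 ^ k * (k.factorial : ℝ) ^ 2 / (2 * k + 1).factorial := by
  induction k with
  | zero => norm_num
  | succ k ih =>
    -- This polynomial vanishes at `±1`, so its derivative integrates to zero and relates the
    -- integrals for `k + 1` and `k`.
    have hd : derivative (X * (1 - X ^ 2 : ℝ[X]) ^ (k + 1)) =
        C (2 * k + 3 : ℝ) * (1 - X ^ 2) ^ (k + 1) + C (-(2 * k + 2) : ℝ) * (1 - X ^ 2) ^ k := by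
      simp only [derivative_mul, derivative_pow, derivative_X, derivative_sub, derivative_one,
        Nat.add_sub_cancel, map_add, map_mul, map_natCast, map_ofNat, map_neg, Nat.cast_add,
        Nat.cast_one, map_one]
      simp
      ring
    have h := integral_eval_derivative (X * (1 - X ^ 2 : ℝ[X]) ^ (k + 1)) (-1) 1
    rw [hd, integral_eval_add, integral_eval_C_mul, integral_eval_C_mul] at h
    simp only [eval_pow, eval_sub, eval_one, eval_X, eval_mul] at h
    rw [ih] at h
    have h1 : ((2 * k + 1).factorial : ℝ) ≠ 0 := by positivity
    rw [show 2 * (k + 1) + 1 = (2 * k + 1) + 1 + 1 by ring, Nat.factorial_succ (2 * k + 1 + 1),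
      Nat.factorial_succ (2 * k + 1), Nat.factorial_succ k]
    have h2 : (2 * k + 3 : ℝ) ≠ 0 := by positivity
    have h3 : (k + 1 : ℝ) ≠ 0 := by positivity
    norm_num at h
    apply mul_left_cancel₀ h2
    push_cast
    field_simp
    field_simp at h
    linear_combination (2 * k + 2) * h

theorem eval_add_eq_sum (p : ℝ[X]) (N : ℕ) (hN : p.natDegree < N) (r h : ℝ) :
    p.eval (r + h) = ∑ j ∈ Finset.range N, (derivative^[j] p).eval r / j.factorial * h ^ j := by
  rw [add_comm, ← taylor_eval, eval_eq_sum_range' (n := N) (by rwa [natDegree_taylor])]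
  refine Finset.sum_congr rfl fun j _ => ?_
  rw [taylor_coeff, ← factorial_smul_hasseDeriv]
  have : (j.factorial : ℝ) ≠ 0 := by positivity
  rw [LinearMap.smul_apply, eval_smul, nsmul_eq_mul]
  field_simp

theorem eval_sub_eval_eq_sum (p : ℝ[X]) (N : ℕ) (hN : p.natDegree < 2 * N) (r h : ℝ) :
    p.eval (r + h) - p.eval (r - h) = ∑ k ∈ Finset.range N,
      2 * ((derivative^[2 * k + 1] p).eval r / (2 * k + 1).factorial * h ^ (2 * k + 1)) := by
  rw [sub_eq_add_neg r h, eval_add_eq_sum p _ hN, eval_add_eq_sum p _ hN,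
    ← Finset.sum_sub_distrib]
  clear hN
  induction N with
  | zero => simp
  | succ N ih =>
    rw [show 2 * (N + 1) = 2 * N + 1 + 1 by ring, Finset.sum_range_succ, Finset.sum_range_succ, ih,
      Finset.sum_range_succ _ N, Even.neg_pow (by simp), Odd.neg_pow ⟨N, rfl⟩]
    ring

/-- The integral of `|P_n|²` over the upper unit semicircle, parametrized by the real part. -/
noncomputable def circInt (n : ℕ) : ℝ :=
  ∫ x in (-1 : ℝ)..1, Complex.normSq (aeval (⟨x, √(1 - x ^ 2)⟩ : ℂ) (leg n))

/-- Integrated term by term, the addition formula becomes the odd part of the Taylor expansion of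
`P_{n+2} - P_n` about `1` with increment `2`, because the derivative of this difference is `(2n + 3)
P_{n+1}`. The value at `1 - 2 = -1` is zero, leaving the one at `1 + 2 = 3`. -/
theorem circInt_eq (n : ℕ) :
    (2 * n + 3) * circInt (n + 1) = ((leg (n + 2)).eval 3 - (leg n).eval 3) / 2 := by
  have h1 : circInt (n + 1) = ∫ x in (-1 : ℝ)..1, ∑ k ∈ Finset.range (n + 2),
      (derivative^[2 * k] (leg (n + 1))).eval 1 / (k.factorial : ℝ) ^ 2 * (1 - x ^ 2) ^ k := by
    refine intervalIntegral.integral_congr fun x hx => ?_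
    rw [Set.uIcc_of_le (by norm_num)] at hx
    refine normSq_aeval_leg (n + 1) ?_
    rw [Complex.normSq_mk, Real.mul_self_sqrt (by nlinarith [hx.1, hx.2])]
    ring
  have hi : ∀ k ∈ Finset.range (n + 2), IntervalIntegrable (fun x : ℝ =>
      (derivative^[2 * k] (leg (n + 1))).eval 1 / (k.factorial : ℝ) ^ 2 * (1 - x ^ 2) ^ k)
      volume (-1) 1 := fun k _ => Continuous.intervalIntegrable (by fun_prop) _ _
  have h2 := eval_sub_eval_eq_sum (leg (n + 2) - leg n) (n + 2) (by
    have := natDegree_sub_le (leg (n + 2)) (leg n)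
    have := natDegree_leg_le (n + 2)
    have := natDegree_leg_le n
    omega) 1 2
  have h3 : ∀ k, derivative^[2 * k + 1] (leg (n + 2) - leg n) =
      C (2 * n + 3 : ℝ) * derivative^[2 * k] (leg (n + 1)) := by
    intro k
    rw [Function.iterate_succ_apply, derivative_sub, derivative_leg_add_two,
      iterate_derivative_C_mul]
  have h4 : (leg (n + 2) - leg n).eval (1 - 2) = 0 := by
    rw [show (1 - 2 : ℝ) = -1 by norm_num, eval_sub, eval_neg_one_leg, eval_neg_one_leg]; ring
  rw [h4, show (1 + 2 : ℝ) = 3 by norm_num, sub_zero, eval_sub] at h2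
  rw [h2, h1, intervalIntegral.integral_finsetSum hi, Finset.mul_sum, Finset.sum_div]
  refine Finset.sum_congr rfl fun k _ => ?_
  rw [intervalIntegral.integral_const_mul, integral_one_sub_sq_pow, h3, eval_mul, eval_C]
  have : (k.factorial : ℝ) ≠ 0 := by positivity
  rw [pow_succ (2 : ℝ), pow_mul]
  norm_num
  field_simp

/-! ### The half-disc integral -/

/-- The coefficients of the real and imaginary parts of the Legendre curve at `x + y i`. -/
noncomputable def reC (x y : ℝ) (j : ℕ) : ℝ := (aeval (⟨x, y⟩ : ℂ) (fleg j)).re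

noncomputable def imC (x y : ℝ) (j : ℕ) : ℝ := (aeval (⟨x, y⟩ : ℂ) (fleg j)).im

/-- `fleg (n + 2)` is half the difference of the derivatives of `P_{n+3}` and `P_{n+1}`, so the
alternate sum telescopes. A general `L` covers real and imaginary parts at once. -/
theorem altSum_linear (L : ℝ[X] →ₗ[ℝ] ℝ) (n : ℕ) :
    altSum (fun j => L (fleg j)) n = L (derivative (leg (n + 1))) / 2 := by
  induction n using Nat.twoStepInduction with
  | zero =>
    have : fleg 0 = (1 / 2 : ℝ) • derivative (leg (0 + 1)) := by
      simp [fleg, leg_zero, leg_one, smul_eq_C_mul]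
    rw [altSum, this, map_smul, smul_eq_mul]; ring
  | one =>
    have : fleg 1 = (1 / 2 : ℝ) • derivative (leg (1 + 1)) := by
      have h := derivative_leg_sub 0
      rw [derivative_C_mul, derivative_sub, leg_zero, derivative_one, sub_zero] at h
      rw [smul_eq_C_mul]; exact h.symm
    rw [altSum, this, map_smul, smul_eq_mul]; ring
  | more n ih _ =>
    have : fleg (n + 2) = (1 / 2 : ℝ) • derivative (leg (n + 3)) -
        (1 / 2 : ℝ) • derivative (leg (n + 1)) := by
      have h := derivative_leg_sub (n + 1)
      rw [derivative_C_mul, derivative_sub] at h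
      rw [← smul_sub, smul_eq_C_mul]; exact h.symm
    rw [altSum, ih, this, map_sub, map_smul, map_smul, smul_eq_mul, smul_eq_mul]
    ring

theorem altSum_reC (x y : ℝ) (n : ℕ) :
    altSum (reC x y) n = (aeval (⟨x, y⟩ : ℂ) (derivative (leg (n + 1)))).re / 2 :=
  altSum_linear (Complex.reLm ∘ₗ (aeval (⟨x, y⟩ : ℂ)).toLinearMap) n

theorem altSum_imC (x y : ℝ) (n : ℕ) :
    altSum (imC x y) n = (aeval (⟨x, y⟩ : ℂ) (derivative (leg (n + 1)))).im / 2 :=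
  altSum_linear (Complex.imLm ∘ₗ (aeval (⟨x, y⟩ : ℂ)).toLinearMap) n

theorem hasDerivAt_normSq_aeval (p : ℝ[X]) (x y : ℝ) :
    HasDerivAt (fun y : ℝ => Complex.normSq (aeval (⟨x, y⟩ : ℂ) p))
      (2 * ((aeval (⟨x, y⟩ : ℂ) p).im * (aeval (⟨x, y⟩ : ℂ) (derivative p)).re -
        (aeval (⟨x, y⟩ : ℂ) p).re * (aeval (⟨x, y⟩ : ℂ) (derivative p)).im)) y := by
  have h1 : HasDerivAt (fun y : ℝ => (⟨x, y⟩ : ℂ)) Complex.I y := by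
    have : (fun y : ℝ => (⟨x, y⟩ : ℂ)) = fun y : ℝ => (x : ℂ) + (y : ℂ) * Complex.I := by
      ext y; exact Complex.mk_eq_add_mul_I x y
    rw [this]
    simpa using ((Complex.ofRealCLM.hasDerivAt (x := y)).mul_const Complex.I).const_add (x : ℂ)
  have h2 : HasDerivAt (fun y : ℝ => aeval (⟨x, y⟩ : ℂ) p)
      (aeval (⟨x, y⟩ : ℂ) (derivative p) * Complex.I) y :=
    (p.hasDerivAt_aeval (⟨x, y⟩ : ℂ)).comp y h1
  have hre := (Complex.reCLM.hasFDerivAt.comp_hasDerivAt y h2)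
  have him := (Complex.imCLM.hasFDerivAt.comp_hasDerivAt y h2)
  have h3 := (hre.mul hre).add (him.mul him)
  refine (h3.congr_deriv ?_).congr_of_eventuallyEq (Filter.Eventually.of_forall fun y => ?_)
  · simp
    ring
  · simp [Complex.normSq_apply]

/-- A quarter of `2 n + 1` times the increment of `|P_n|²` from the real axis to the circle. -/
noncomputable def incr (n : ℕ) (x : ℝ) : ℝ :=
  (2 * n + 1) / 2 * (Complex.normSq (aeval (⟨x, √(1 - x ^ 2)⟩ : ℂ) (leg n)) - (leg n).eval x ^ 2)

theorem continuous_mk_aeval (p : ℝ[X]) : Continuous fun z : ℝ × ℝ => aeval (⟨z.1, z.2⟩ : ℂ) p := by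
  have : Continuous fun z : ℝ × ℝ => (⟨z.1, z.2⟩ : ℂ) := Complex.equivRealProdCLM.symm.continuous
  exact p.continuous_aeval.comp this

theorem continuous_incr (n : ℕ) : Continuous (incr n) := by
  have h : Continuous fun x : ℝ => aeval (⟨x, √(1 - x ^ 2)⟩ : ℂ) (leg n) :=
    (continuous_mk_aeval (leg n)).comp (g := fun z : ℝ × ℝ => aeval (⟨z.1, z.2⟩ : ℂ) (leg n))
      (f := fun x : ℝ => (x, √(1 - x ^ 2))) (by fun_prop)
  have h2 := (leg n).continuous
  unfold incr
  exact continuous_const.mul ((Complex.continuous_normSq.comp h).sub (h2.pow 2))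

theorem integral_incr (n : ℕ) : ∫ x in (-1 : ℝ)..1, incr (n + 1) x =
    ((leg (n + 2)).eval 3 - (leg n).eval 3) / 4 - 1 := by
  have h := circInt_eq n
  have h2 := integral_leg_mul_self (n + 1)
  have hc : Continuous fun x : ℝ => aeval (⟨x, √(1 - x ^ 2)⟩ : ℂ) (leg (n + 1)) :=
    (continuous_mk_aeval (leg (n + 1))).comp
      (g := fun z : ℝ × ℝ => aeval (⟨z.1, z.2⟩ : ℂ) (leg (n + 1)))
      (f := fun x : ℝ => (x, √(1 - x ^ 2))) (by fun_prop)
  unfold incr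
  have hA : IntervalIntegrable (fun x : ℝ => Complex.normSq
      (aeval (⟨x, √(1 - x ^ 2)⟩ : ℂ) (leg (n + 1)))) volume (-1) 1 :=
    (Complex.continuous_normSq.comp hc).intervalIntegrable _ _
  have hB : IntervalIntegrable (fun x : ℝ => (leg (n + 1)).eval x ^ 2) volume (-1) 1 :=
    ((leg (n + 1)).continuous.pow 2).intervalIntegrable _ _
  rw [intervalIntegral.integral_const_mul, intervalIntegral.integral_sub hA hB]
  simp only [pow_two ((leg (n + 1)).eval _), ← eval_mul, h2]
  change _ * (circInt (n + 1) - _) = _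
  push_cast
  have h3 : (2 * (n : ℝ) + 3) ≠ 0 := by positivity
  have h4 : (2 * ((n : ℝ) + 1) + 1) ≠ 0 := by positivity
  field_simp
  linear_combination 4 * h

/-- By `altSum_linear` the integrand is `(2n + 3) / 2` times the `y`-derivative of `|P_{n+1}(x +
iy)|²`, so only the values on the circle and on the real axis remain. -/
theorem integral_wronskian (n : ℕ) (x : ℝ) :
    ∫ y in (0 : ℝ)..√(1 - x ^ 2), 4 * (imC x y (n + 1) * altSum (reC x y) n -
      reC x y (n + 1) * altSum (imC x y) n) = incr (n + 1) x := by
  have h1 : ∀ y, 4 * (imC x y (n + 1) * altSum (reC x y) n -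
      reC x y (n + 1) * altSum (imC x y) n) = (2 * (n + 1 : ℕ) + 1) / 2 *
      (2 * ((aeval (⟨x, y⟩ : ℂ) (leg (n + 1))).im * (aeval (⟨x, y⟩ : ℂ) (derivative (leg (n + 1)))).re -
        (aeval (⟨x, y⟩ : ℂ) (leg (n + 1))).re *
          (aeval (⟨x, y⟩ : ℂ) (derivative (leg (n + 1)))).im)) := by
    intro y
    rw [altSum_reC, altSum_imC, imC, reC, fleg, map_mul, aeval_C]
    simp only [Complex.coe_algebraMap, Complex.re_ofReal_mul, Complex.im_ofReal_mul]
    ring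
  have hc : ∀ p : ℝ[X], Continuous fun y : ℝ => aeval (⟨x, y⟩ : ℂ) p := fun p =>
    (continuous_mk_aeval p).comp (g := fun z : ℝ × ℝ => aeval (⟨z.1, z.2⟩ : ℂ) p)
      (f := fun y : ℝ => (x, y)) (by fun_prop)
  simp only [h1]
  rw [intervalIntegral.integral_const_mul, intervalIntegral.integral_eq_sub_of_hasDerivAt
    (fun y _ => hasDerivAt_normSq_aeval (leg (n + 1)) x y), incr]
  · congr 2
    have : (⟨x, 0⟩ : ℂ) = algebraMap ℝ ℂ x := rfl
    rw [this, aeval_algebraMap_apply, coe_aeval_eq_eval, Complex.coe_algebraMap,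
      Complex.normSq_ofReal, pow_two]
  · refine Continuous.intervalIntegrable ?_ _ _
    have h2 := hc (leg (n + 1))
    have h3 := hc (derivative (leg (n + 1)))
    have r2 := Complex.continuous_re.comp h2
    have r3 := Complex.continuous_re.comp h3
    have i2 := Complex.continuous_im.comp h2
    have i3 := Complex.continuous_im.comp h3
    exact continuous_const.mul ((i2.mul r3).sub (r2.mul i3))

theorem continuous_reC (j : ℕ) : Continuous fun z : ℝ × ℝ => reC z.1 z.2 j :=
  Complex.continuous_re.comp (continuous_mk_aeval _)

theorem continuous_imC (j : ℕ) : Continuous fun z : ℝ × ℝ => imC z.1 z.2 j :=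
  Complex.continuous_im.comp (continuous_mk_aeval _)

theorem continuous_altSum {α : Type*} [TopologicalSpace α] {c : α → ℕ → ℝ}
    (hc : ∀ j, Continuous fun z => c z j) (n : ℕ) : Continuous fun z => altSum (c z) n := by
  induction n using Nat.twoStepInduction with
  | zero => exact hc 0
  | one => exact hc 1
  | more n ih _ => exact (hc _).add ih

theorem continuous_altPair {α : Type*} [TopologicalSpace α] {c c' : α → ℕ → ℝ}
    (hc : ∀ j, Continuous fun z => c z j) (hc' : ∀ j, Continuous fun z => c' z j) (n : ℕ) :
    Continuous fun z => altPair (c z) (c' z) n := by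
  have h := continuous_altSum hc
  have h' := continuous_altSum hc'
  induction n using Nat.twoStepInduction with
  | zero => exact ((hc 1).mul (h' 0)).sub ((hc' 1).mul (h 0))
  | one => exact ((hc 2).mul (h' 1)).sub ((hc' 2).mul (h 1))
  | more n ih _ => exact ih.add (((hc _).mul (h' _)).sub ((hc' _).mul (h _)))

/-- `f` is the sum of the functions `incr` of index `n + 1`, `n - 1`, and so on. Their integrals
`(P_{k+2}(3) - P_k(3)) / 4 - 1` telescope in steps of two down to `P_0(3) = 1` or `P_1(3) = 3`. -/
theorem exists_integral_altPair (n : ℕ) :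
    ∃ f : ℝ → ℝ, Continuous f ∧
      (∀ x, ∫ y in (0 : ℝ)..√(1 - x ^ 2), 4 * altPair (imC x y) (reC x y) n = f x) ∧
      ∫ x in (-1 : ℝ)..1, f x = ((leg (n + 2)).eval 3 - 2 * (n + 2) - 1) / 4 := by
  have hI : ∀ j (x : ℝ), Continuous fun y : ℝ => imC x y j := fun j x =>
    (continuous_imC j).comp (f := fun y : ℝ => (x, y)) (by fun_prop)
  have hR : ∀ j (x : ℝ), Continuous fun y : ℝ => reC x y j := fun j x =>
    (continuous_reC j).comp (f := fun y : ℝ => (x, y)) (by fun_prop)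
  induction n using Nat.twoStepInduction with
  | zero =>
    refine ⟨incr 1, continuous_incr 1, fun x => integral_wronskian 0 x, ?_⟩
    rw [integral_incr 0, leg_zero, eval_one]; norm_num; ring
  | one =>
    refine ⟨incr 2, continuous_incr 2, fun x => integral_wronskian 1 x, ?_⟩
    rw [integral_incr 1, leg_one, eval_X]; norm_num; ring
  | more n ih _ =>
    obtain ⟨f, hf, h1, h2⟩ := ih
    refine ⟨fun x => f x + incr (n + 3) x, hf.add (continuous_incr _), fun x => ?_, ?_⟩
    · simp only [altPair, mul_add]
      rw [intervalIntegral.integral_add, h1]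
      · congr 1
        exact integral_wronskian (n + 2) x
      · exact (continuous_const.mul (continuous_altPair (hI · x) (hR · x) n)).intervalIntegrable _ _
      · have a := continuous_altSum (hI · x) (n + 2)
        have b := continuous_altSum (hR · x) (n + 2)
        exact (continuous_const.mul (((hI _ x).mul b).sub ((hR _ x).mul a))).intervalIntegrable _ _
    · rw [intervalIntegral.integral_add (hf.intervalIntegrable _ _)
        ((continuous_incr _).intervalIntegrable _ _), h2, integral_incr (n + 2)]
      push_cast
      ring

/-! ### Polynomials, coefficients and roots -/

theorem poly_eq {d : ℕ} (a : Fin d → ℝ) :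
    poly a = X ^ d + ∑ i : Fin d, C (a i.rev) * X ^ (i : ℕ) := by
  rw [poly, ← Equiv.sum_comp Fin.revPerm]
  congr 1
  refine Finset.sum_congr rfl fun i _ => ?_
  congr 2
  simp only [Fin.revPerm_apply, Fin.val_rev]
  omega

theorem degree_poly_sum_lt {d : ℕ} (a : Fin d → ℝ) :
    (∑ i : Fin d, C (a i.rev) * X ^ (i : ℕ)).degree < (d : WithBot ℕ) :=
  degree_sum_fin_lt _

theorem poly_monic {d : ℕ} (a : Fin d → ℝ) : (poly a).Monic := by
  rw [poly_eq]
  exact monic_X_pow_add (degree_poly_sum_lt a)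

theorem natDegree_poly {d : ℕ} (a : Fin d → ℝ) : (poly a).natDegree = d := by
  rw [poly_eq, natDegree_add_eq_left_of_degree_lt (by simpa using degree_poly_sum_lt a),
    natDegree_X_pow]

theorem coeff_poly {d : ℕ} (a : Fin d → ℝ) (i : Fin d) : (poly a).coeff (d - 1 - i) = a i := by
  rw [poly_eq, coeff_add, coeff_X_pow, if_neg (by omega), zero_add, finsetSum_coeff,
    Finset.sum_eq_single i.rev]
  · rw [coeff_C_mul, coeff_X_pow, if_pos (by rw [Fin.val_rev]; omega), Fin.rev_rev, mul_one]
  · intro j _ hj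
    rw [coeff_C_mul, coeff_X_pow, if_neg, mul_zero]
    intro h
    apply hj
    ext
    rw [Fin.val_rev]; omega
  · simp

theorem poly_injective {d : ℕ} : Function.Injective (poly : (Fin d → ℝ) → ℝ[X]) := by
  intro a b h
  ext i
  rw [← coeff_poly a, ← coeff_poly b, h]

/-- The monic polynomial with the given roots. -/
noncomputable def rootPoly {d : ℕ} (r : Fin d → ℂ) : ℂ[X] := ∏ k, (X - C (r k))

theorem rootPoly_monic {d : ℕ} (r : Fin d → ℂ) : (rootPoly r).Monic :=
  monic_prod_of_monic _ _ fun _ _ => monic_X_sub_C _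

theorem natDegree_rootPoly {d : ℕ} (r : Fin d → ℂ) : (rootPoly r).natDegree = d := by
  rw [rootPoly, natDegree_prod_of_monic _ _ fun _ _ => monic_X_sub_C _]
  simp

theorem roots_rootPoly {d : ℕ} (r : Fin d → ℂ) :
    (rootPoly r).roots = Finset.univ.val.map r := by
  have := roots_multiset_prod_X_sub_C (Finset.univ.val.map r)
  rw [Multiset.map_map] at this
  exact this

/-- The real parts of the coefficients of the monic polynomial with the given roots. -/
noncomputable def rootCoeff {d : ℕ} (r : Fin d → ℂ) : Fin d → ℝ :=
  fun i => ((rootPoly r).coeff (d - 1 - i)).re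

/-- Families of complex numbers that are permuted by complex conjugation. -/
def ConjInv {d : ℕ} (r : Fin d → ℂ) : Prop :=
  ∃ σ : Equiv.Perm (Fin d), ∀ k, (starRingEnd ℂ) (r k) = r (σ k)

/-- Conjugation permutes the linear factors, so the coefficients are real and taking real parts in
`rootCoeff` loses nothing. -/
theorem map_poly_rootCoeff {d : ℕ} {r : Fin d → ℂ} (h : ConjInv r) :
    (poly (rootCoeff r)).map (algebraMap ℝ ℂ) = rootPoly r := by
  obtain ⟨σ, hσ⟩ := h
  have hconj : (rootPoly r).map (starRingEnd ℂ) = rootPoly r := by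
    rw [rootPoly, Polynomial.map_prod]
    refine Eq.trans ?_ (Equiv.prod_comp σ fun k => X - C (r k))
    refine Finset.prod_congr rfl fun k _ => ?_
    rw [Polynomial.map_sub, map_X, map_C, hσ]
  have hre : ∀ n, (((rootPoly r).coeff n).re : ℂ) = (rootPoly r).coeff n := by
    intro n
    have := congrArg (fun p => coeff p n) hconj
    simp only [coeff_map] at this
    exact Complex.conj_eq_iff_re.1 this
  ext n
  rcases lt_trichotomy n d with hn | hn | hn
  · have := coeff_poly (rootCoeff r) ⟨d - 1 - n, by omega⟩
    simp only [show d - 1 - (d - 1 - n) = n by omega] at this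
    rw [coeff_map, this, rootCoeff]
    simp only [show d - 1 - (d - 1 - n) = n by omega]
    exact hre n
  · subst hn
    have h1 := (poly_monic (rootCoeff r)).coeff_natDegree
    have h2 := (rootPoly_monic r).coeff_natDegree
    rw [natDegree_poly] at h1
    rw [natDegree_rootPoly] at h2
    rw [coeff_map, h1, h2, map_one]
  · rw [coeff_map, coeff_eq_zero_of_natDegree_lt (by rwa [natDegree_poly]), map_zero,
      coeff_eq_zero_of_natDegree_lt (by rwa [natDegree_rootPoly])]

theorem aroots_poly_rootCoeff {d : ℕ} {r : Fin d → ℂ} (h : ConjInv r) :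
    (poly (rootCoeff r)).aroots ℂ = Finset.univ.val.map r := by
  rw [aroots, map_poly_rootCoeff h, roots_rootPoly]

theorem eq_rootCoeff {d : ℕ} {a : Fin d → ℝ} {r : Fin d → ℂ} (h : ConjInv r)
    (ha : (poly a).aroots ℂ = Finset.univ.val.map r) : a = rootCoeff r := by
  apply poly_injective
  apply map_injective (algebraMap ℝ ℂ) (algebraMap ℝ ℂ).injective
  rw [map_poly_rootCoeff h, (IsAlgClosed.splits ((poly a).map (algebraMap ℝ ℂ))).eq_prod_roots_of_monic
    ((poly_monic a).map _)]
  change (Multiset.map _ ((poly a).aroots ℂ)).prod = _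
  rw [ha, Multiset.map_map]
  rfl

theorem eval_rootPoly {d : ℕ} {r : Fin d → ℂ} (h : ConjInv r) (t : ℂ) :
    ∏ k, (t - r k) = t ^ d + ∑ i : Fin d, (rootCoeff r i : ℂ) * t ^ (d - 1 - (i : ℕ)) := by
  have h1 := congrArg (eval t) (map_poly_rootCoeff h)
  simp only [rootPoly, eval_prod, eval_sub, eval_X, eval_C] at h1
  rw [← h1, poly]
  simp

/-! ### The Jacobian of the passage from roots to coefficients -/

theorem differentiable_coeff_prod {d : ℕ} {E : Type*} [NormedAddCommGroup E] [NormedSpace ℝ E]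
    (r : Fin d → E →L[ℝ] ℂ) (s : Finset (Fin d)) (n : ℕ) :
    Differentiable ℝ fun v => (∏ k ∈ s, (X - C (r k v))).coeff n := by
  induction s using Finset.induction_on generalizing n with
  | empty => simp
  | insert k s hk ih =>
    simp only [Finset.prod_insert hk, sub_mul, coeff_sub, coeff_C_mul]
    refine Differentiable.sub ?_ ((r k).differentiable.mul (ih n))
    cases n with
    | zero => simp
    | succ n => simpa only [coeff_X_mul] using ih n

theorem differentiable_rootCoeff {d : ℕ} {E : Type*} [NormedAddCommGroup E] [NormedSpace ℝ E]
    (r : Fin d → E →L[ℝ] ℂ) : Differentiable ℝ fun v => rootCoeff fun k => r k v := by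
  rw [differentiable_pi]
  intro i
  exact Complex.reCLM.differentiable.comp (differentiable_coeff_prod r Finset.univ _)

theorem norm_prod_erase {d : ℕ} (r : Fin d → ℂ) :
    ‖∏ k, ∏ l ∈ Finset.univ.erase k, (r k - r l)‖ = ‖vdm r‖ ^ 2 := by
  have h := Finset.prod_prod_Ioi_mul_eq_prod_prod_off_diag (fun l k => r k - r l)
  have h1 : ∏ k, ∏ l ∈ Finset.univ.erase k, (r k - r l) =
      ∏ i, ∏ j ∈ {i}ᶜ, (r i - r j) := by
    refine Finset.prod_congr rfl fun k _ => Finset.prod_congr ?_ fun _ _ => rfl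
    ext; simp
  rw [h1, ← h]
  simp only [norm_prod, norm_mul, vdm, ← Finset.prod_pow]
  refine Finset.prod_congr rfl fun i _ => Finset.prod_congr rfl fun j _ => ?_
  rw [norm_sub_rev (r j), pow_two]

theorem norm_det_rev_vandermonde {d : ℕ} (r : Fin d → ℂ) :
    ‖(Matrix.of fun k i : Fin d => r k ^ (d - 1 - (i : ℕ))).det‖ = ‖vdm r‖ := by
  have h : (Matrix.of fun k i : Fin d => r k ^ (d - 1 - (i : ℕ))) =
      (Matrix.vandermonde r).submatrix id Fin.revPerm := by
    ext k i
    simp only [Matrix.of_apply, Matrix.submatrix_apply, Matrix.vandermonde_apply, id,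
      Fin.revPerm_apply, Fin.val_rev]
    congr 1; omega
  rw [h, Matrix.det_permute', norm_mul, Matrix.det_vandermonde, vdm]
  have : ‖((Equiv.Perm.sign (Fin.revPerm : Equiv.Perm (Fin d)) : ℤ) : ℂ)‖ = 1 := by
    rcases Int.units_eq_one_or (Equiv.Perm.sign (Fin.revPerm : Equiv.Perm (Fin d))) with h | h <;>
      simp [h]
  rw [this, one_mul]
  simp only [norm_prod]
  refine Finset.prod_congr rfl fun i _ => Finset.prod_congr rfl fun j _ => norm_sub_rev _ _

/-- Differentiating `∏ (t - r_k) = t ^ d + ∑ a_i t ^ (d - 1 - i)` in the parameters and putting `t =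
r_k` factors the Jacobian: a Vandermonde matrix times it equals a diagonal matrix times the matrix
of `r`. The diagonal contributes the squared Vandermonde product, one power of which cancels. Real
roots and conjugate pairs are treated alike. -/
theorem abs_det_fderiv_rootCoeff {d : ℕ} (r : Fin d → (Fin d → ℝ) →L[ℝ] ℂ)
    (hr : ∀ v, ConjInv fun k => r k v) (v : Fin d → ℝ)
    (hv : Function.Injective fun k => r k v) :
    |(fderiv ℝ (fun v => rootCoeff fun k => r k v) v).det| =
      ‖(Matrix.of fun k j => r k (Pi.single j 1)).det‖ * ‖vdm fun k => r k v‖ := by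
  set T := fun v => rootCoeff fun k => r k v with hT
  set D := fderiv ℝ T v with hD
  have hTD : HasFDerivAt T D v := (differentiable_rootCoeff r v).hasFDerivAt
  have key : ∀ (t : ℂ) (h : Fin d → ℝ), ∑ i : Fin d, (D h i : ℂ) * t ^ (d - 1 - (i : ℕ)) =
      -∑ k, (∏ l ∈ Finset.univ.erase k, (t - r l v)) * r k h := by
    intro t h
    have h1 : HasFDerivAt (fun v => ∏ k, (t - r k v))
        (∑ k, (∏ l ∈ Finset.univ.erase k, (t - r l v)) • (-(r k))) v :=
      HasFDerivAt.finsetProd fun k _ => (r k).hasFDerivAt.const_sub t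
    have h2 : HasFDerivAt (fun v => t ^ d + ∑ i : Fin d, (T v i : ℂ) * t ^ (d - 1 - (i : ℕ)))
        (∑ i : Fin d, (t ^ (d - 1 - (i : ℕ))) •
          (Complex.ofRealCLM.comp ((ContinuousLinearMap.proj i).comp D))) v := by
      refine HasFDerivAt.const_add _ (HasFDerivAt.fun_sum fun i _ => ?_)
      have h3 : HasFDerivAt (fun v => (T v i : ℂ))
          (Complex.ofRealCLM.comp ((ContinuousLinearMap.proj i).comp D)) v :=
        Complex.ofRealCLM.hasFDerivAt.comp v (hasFDerivAt_pi'.1 hTD i)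
      exact h3.mul_const _
    have h3 : (fun v => ∏ k, (t - r k v)) =
        fun v => t ^ d + ∑ i : Fin d, (T v i : ℂ) * t ^ (d - 1 - (i : ℕ)) :=
      funext fun v => eval_rootPoly (hr v) t
    rw [← h3] at h2
    have h4 := congrArg (fun L => L h) (h2.unique h1)
    simp only [sum_apply, smul_apply,
      ContinuousLinearMap.comp_apply, ContinuousLinearMap.proj_apply, Complex.ofRealCLM_apply,
      neg_apply, smul_eq_mul, mul_neg, Finset.sum_neg_distrib] at h4
    rw [← h4]
    exact Finset.sum_congr rfl fun i _ => mul_comm _ _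
  have hmat : (Matrix.of fun k i : Fin d => r k v ^ (d - 1 - (i : ℕ))) *
      (LinearMap.toMatrix' (D : (Fin d → ℝ) →ₗ[ℝ] Fin d → ℝ)).map (algebraMap ℝ ℂ) =
      Matrix.diagonal (fun k => -∏ l ∈ Finset.univ.erase k, (r k v - r l v)) *
        Matrix.of fun k j => r k (Pi.single j 1) := by
    ext k j
    rw [Matrix.mul_apply, Matrix.diagonal_mul]
    have := key (r k v) (Pi.single j 1)
    -- At `t = r k v` every product with `m ≠ k` contains the zero factor `l = k`.
    have hs : ∑ m, (∏ l ∈ Finset.univ.erase m, (r k v - r l v)) * r m (Pi.single j 1) =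
        (∏ l ∈ Finset.univ.erase k, (r k v - r l v)) * r k (Pi.single j 1) := by
      refine Finset.sum_eq_single k (fun m _ hm => ?_) (by simp)
      rw [Finset.prod_eq_zero (Finset.mem_erase.2 ⟨hm.symm, Finset.mem_univ k⟩) (sub_self _),
        zero_mul]
    rw [hs] at this
    · rw [neg_mul, Matrix.of_apply, ← this]
      refine Finset.sum_congr rfl fun i _ => ?_
      rw [Matrix.of_apply, Matrix.map_apply, LinearMap.toMatrix'_apply, mul_comm]
      rfl
  have hdet := congrArg (fun M => ‖M.det‖) hmat
  simp only [Matrix.det_mul, norm_mul, norm_det_rev_vandermonde, Matrix.det_diagonal] at hdet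
  have h5 : (∏ k, -∏ l ∈ Finset.univ.erase k, (r k v - r l v)) =
      (-1) ^ d * ∏ k, ∏ l ∈ Finset.univ.erase k, (r k v - r l v) := by
    rw [Finset.prod_neg, Finset.card_univ, Fintype.card_fin]
  have h6 : ‖((LinearMap.toMatrix' (D : (Fin d → ℝ) →ₗ[ℝ] Fin d → ℝ)).map
      (algebraMap ℝ ℂ)).det‖ = |D.det| := by
    have : ((LinearMap.toMatrix' (D : (Fin d → ℝ) →ₗ[ℝ] Fin d → ℝ)).map (algebraMap ℝ ℂ)).det =
        algebraMap ℝ ℂ D.det := by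
      rw [ContinuousLinearMap.det, ← LinearMap.det_toMatrix']
      exact ((algebraMap ℝ ℂ).map_det _).symm
    rw [this]
    simp
  rw [h5, h6, norm_mul, norm_prod_erase (fun k => r k v)] at hdet
  simp only [norm_pow, norm_neg, norm_one, one_pow, one_mul] at hdet
  have h7 : ‖vdm fun k => r k v‖ ≠ 0 := norm_ne_zero_iff.2 (vdm_ne_zero_iff.2 hv)
  apply mul_left_cancel₀ h7
  rw [hdet]
  ring

/-- The change of variables from roots to coefficients. -/
theorem volume_image_rootCoeff {d : ℕ} (r : Fin d → (Fin d → ℝ) →L[ℝ] ℂ)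
    (hr : ∀ v, ConjInv fun k => r k v) {D : Set (Fin d → ℝ)} (hD : MeasurableSet D)
    (hinj : Set.InjOn (fun v => rootCoeff fun k => r k v) D)
    (hae : ∀ᵐ v, v ∈ D → Function.Injective fun k => r k v) :
    volume ((fun v => rootCoeff fun k => r k v) '' D) =
      ∫⁻ v in D, ENNReal.ofReal
        (‖(Matrix.of fun k j => r k (Pi.single j 1)).det‖ * ‖vdm fun k => r k v‖) := by
  rw [← lintegral_abs_det_fderiv_eq_addHaar_image volume hD
    (fun v _ => (differentiable_rootCoeff r v).hasFDerivAt.hasFDerivWithinAt) hinj]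
  refine lintegral_congr_ae ((ae_restrict_iff' hD).2 ?_)
  filter_upwards [hae] with v hv hvD
  rw [abs_det_fderiv_rootCoeff r hr v (hv hvD)]

/-! ### Parametrizing the regions by roots -/

/-- Ordered tuples of points in `(-1, 1)`. -/
def monoBox (m : ℕ) : Set (Fin m → ℝ) := {x | Monotone x ∧ ∀ i, |x i| < 1}

theorem measurableSet_monotone (m : ℕ) : MeasurableSet {x : Fin m → ℝ | Monotone x} := by
  simp only [Monotone, Set.ofPred_forall]
  exact MeasurableSet.iInter fun i => MeasurableSet.iInter fun j => MeasurableSet.iInter fun _ =>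
    measurableSet_le (measurable_pi_apply i) (measurable_pi_apply j)

theorem measurableSet_monoBox (m : ℕ) : MeasurableSet (monoBox m) := by
  refine (measurableSet_monotone m).inter (?_ : MeasurableSet {x : Fin m → ℝ | ∀ i, |x i| < 1})
  simp only [Set.ofPred_forall]
  exact MeasurableSet.iInter fun i => measurableSet_lt (measurable_pi_apply i).abs measurable_const

theorem monotone_eq_of_map_eq {m : ℕ} {x y : Fin m → ℝ} (hx : Monotone x) (hy : Monotone y)
    (h : Finset.univ.val.map x = Finset.univ.val.map y) : x = y := by
  rw [Fin.univ_val_map, Fin.univ_val_map, Multiset.coe_eq_coe] at h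
  exact List.ofFn_injective (h.eq_of_sortedLE hx.sortedLE_ofFn hy.sortedLE_ofFn)

theorem exists_monotone_map_eq {m : ℕ} (M : Multiset ℝ) (h : M.card = m) :
    ∃ x : Fin m → ℝ, Monotone x ∧ Finset.univ.val.map x = M := by
  subst h
  have hl : M.toList.length = M.card := Multiset.length_toList M
  let f : Fin M.card → ℝ := fun i => M.toList.get (i.cast hl.symm)
  have hf : Finset.univ.val.map f = M := by
    rw [Fin.univ_val_map]
    conv_rhs => rw [← Multiset.coe_toList M]
    congr 1
    refine List.ext_get (by simp [hl]) fun n h1 h2 => ?_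
    simp [f]
  refine ⟨f ∘ Tuple.sort f, Tuple.monotone_sort f, ?_⟩
  conv_rhs => rw [← hf]
  rw [← Multiset.map_map]
  congr 1
  simp

/-- The real root vector. -/
noncomputable def rReal (d : ℕ) (k : Fin d) : (Fin d → ℝ) →L[ℝ] ℂ :=
  Complex.ofRealCLM.comp (ContinuousLinearMap.proj k)

theorem rReal_apply {d : ℕ} (k : Fin d) (v : Fin d → ℝ) : rReal d k v = (v k : ℂ) := rfl

theorem conjInv_rReal {d : ℕ} (v : Fin d → ℝ) : ConjInv fun k => rReal d k v :=
  ⟨1, fun k => by simp [rReal_apply]⟩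

/-- The root vector with one complex conjugate pair. -/
noncomputable def rPair (m : ℕ) : Fin (m + 2) → (Fin (m + 2) → ℝ) →L[ℝ] ℂ :=
  Matrix.vecCons (rReal (m + 2) 0 + Complex.I • rReal (m + 2) 1)
    (Matrix.vecCons (rReal (m + 2) 0 - Complex.I • rReal (m + 2) 1)
      fun k => rReal (m + 2) k.succ.succ)

theorem rPair_eq (m : ℕ) (v : Fin (m + 2) → ℝ) : (fun k => rPair m k v) =
    Matrix.vecCons (⟨v 0, v 1⟩ : ℂ) (Matrix.vecCons ((starRingEnd ℂ) ⟨v 0, v 1⟩)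
      fun k => (v k.succ.succ : ℂ)) := by
  ext k
  cases k using Fin.cases with
  | zero => simp [rPair, rReal_apply, Complex.ext_iff]
  | succ k =>
    cases k using Fin.cases with
    | zero => simp [rPair, rReal_apply, Complex.ext_iff]
    | succ k => simp [rPair, rReal_apply]

theorem conjInv_rPair {m : ℕ} (v : Fin (m + 2) → ℝ) : ConjInv fun k => rPair m k v := by
  refine ⟨Equiv.swap 0 1, fun k => ?_⟩
  have h := rPair_eq m v
  have h' : ∀ k, rPair m k v = Matrix.vecCons (⟨v 0, v 1⟩ : ℂ)
    (Matrix.vecCons ((starRingEnd ℂ) ⟨v 0, v 1⟩) fun k => (v k.succ.succ : ℂ)) k := congrFun h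
  simp only [h']
  cases k using Fin.cases with
  | zero => simp
  | succ k =>
    cases k using Fin.cases with
    | zero => simp
    | succ k =>
      rw [Equiv.swap_apply_of_ne_of_ne (Fin.succ_ne_zero _)
        (by rw [← Fin.succ_zero_eq_one]; exact fun h => Fin.succ_ne_zero k (Fin.succ_injective _ h))]
      simp

theorem map_vecCons {α : Type*} {m : ℕ} (a : α) (v : Fin m → α) :
    (Finset.univ.val : Multiset (Fin (m + 1))).map (Matrix.vecCons a v) =
      a ::ₘ Finset.univ.val.map v := by
  rw [Fin.univ_val_map, Fin.univ_val_map, List.ofFn_succ]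
  simp

theorem map_rPair (m : ℕ) (v : Fin (m + 2) → ℝ) : Finset.univ.val.map (fun k => rPair m k v) =
    (⟨v 0, v 1⟩ : ℂ) ::ₘ (starRingEnd ℂ) ⟨v 0, v 1⟩ ::ₘ
      (Finset.univ.val.map fun k : Fin m => v k.succ.succ).map ((↑) : ℝ → ℂ) := by
  rw [rPair_eq, map_vecCons, map_vecCons, Multiset.map_map]
  rfl

/-- Root vectors of the contractive polynomials with one complex conjugate pair. -/
def pairDom (m : ℕ) : Set (Fin (m + 2) → ℝ) :=
  {v | (0 < v 1 ∧ v 0 ^ 2 + v 1 ^ 2 < 1) ∧ (fun k : Fin m => v k.succ.succ) ∈ monoBox m}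

theorem measurableSet_pairDom (m : ℕ) : MeasurableSet (pairDom m) := by
  refine MeasurableSet.inter (MeasurableSet.inter ?_ ?_) ?_
  · exact measurableSet_lt measurable_const (measurable_pi_apply 1)
  · exact measurableSet_lt (((measurable_pi_apply 0).pow_const 2).add
      ((measurable_pi_apply 1).pow_const 2)) measurable_const
  · exact (measurableSet_monoBox m).preimage
      (measurable_pi_lambda _ fun k => measurable_pi_apply _)

theorem filter_map_ofReal (M : Multiset ℝ) :
    (M.map ((↑) : ℝ → ℂ)).filter (fun z => z.im ≠ 0) = 0 := by
  rw [Multiset.filter_eq_nil]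
  intro z hz
  obtain ⟨x, -, rfl⟩ := Multiset.mem_map.1 hz
  simp

theorem exists_ofReal_of_im_eq_zero {M : Multiset ℂ} (h : ∀ z ∈ M, z.im = 0) :
    (M.map Complex.re).map ((↑) : ℝ → ℂ) = M := by
  rw [Multiset.map_map]
  conv_rhs => rw [← Multiset.map_id M]
  refine Multiset.map_congr rfl fun z hz => ?_
  exact Complex.ext rfl (h z hz).symm

theorem card_aroots_poly {d : ℕ} (a : Fin d → ℝ) : ((poly a).aroots ℂ).card = d := by
  have := (IsAlgClosed.splits ((poly a).map (algebraMap ℝ ℂ))).natDegree_eq_card_roots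
  rw [(poly_monic a).natDegree_map, natDegree_poly] at this
  exact this.symm

theorem map_conj_aroots (p : ℝ[X]) : (p.aroots ℂ).map (starRingEnd ℂ) = p.aroots ℂ := by
  have h := (IsAlgClosed.splits (p.map (algebraMap ℝ ℂ))).roots_map (starRingEnd ℂ)
  rw [Polynomial.map_map] at h
  have e : (starRingEnd ℂ).comp (algebraMap ℝ ℂ) = algebraMap ℝ ℂ := by
    ext x; simp
  rw [e] at h
  exact h.symm

theorem image_monoBox (d : ℕ) :
    (fun v => rootCoeff fun k => rReal d k v) '' monoBox d = regionPairs d 0 := by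
  have hmap : ∀ v : Fin d → ℝ, Finset.univ.val.map (fun k => rReal d k v) =
      (Finset.univ.val.map v).map ((↑) : ℝ → ℂ) := fun v => by
    rw [Multiset.map_map]; rfl
  ext a
  constructor
  · rintro ⟨v, hv, rfl⟩
    have h := aroots_poly_rootCoeff (conjInv_rReal v)
    refine ⟨?_, ?_⟩
    · intro z hz
      rw [h, hmap, Multiset.map_map] at hz
      obtain ⟨k, -, rfl⟩ := Multiset.mem_map.1 hz
      simpa using hv.2 k
    · rw [h, hmap, filter_map_ofReal]; simp
  · rintro ⟨h1, h2⟩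
    rw [mul_zero, Multiset.card_eq_zero, Multiset.filter_eq_nil] at h2
    have h3 := exists_ofReal_of_im_eq_zero (fun z hz => not_not.1 (h2 z hz))
    obtain ⟨x, hx, hx'⟩ := exists_monotone_map_eq (((poly a).aroots ℂ).map Complex.re) (m := d)
      (by rw [Multiset.card_map, card_aroots_poly])
    rw [← hx', ← hmap] at h3
    refine ⟨x, ⟨hx, fun i => ?_⟩, (eq_rootCoeff (conjInv_rReal x) h3.symm).symm⟩
    have := h1 (x i) (by
      rw [← h3]; exact Multiset.mem_map.2 ⟨i, Finset.mem_univ i, rfl⟩)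
    simpa using this

theorem injOn_monoBox (d : ℕ) :
    Set.InjOn (fun v => rootCoeff fun k => rReal d k v) (monoBox d) := by
  intro v hv w hw h
  have h1 := aroots_poly_rootCoeff (conjInv_rReal v)
  have h2 := aroots_poly_rootCoeff (conjInv_rReal w)
  simp only at h
  rw [h, h2] at h1
  apply monotone_eq_of_map_eq hv.1 hw.1
  apply Multiset.map_injective Complex.ofReal_injective
  rw [Multiset.map_map, Multiset.map_map]
  exact h1.symm

theorem image_pairDom (m : ℕ) :
    (fun v => rootCoeff fun k => rPair m k v) '' pairDom m = regionPairs (m + 2) 1 := by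
  ext a
  constructor
  · rintro ⟨v, ⟨⟨hv1, hv2⟩, -, hv3⟩, rfl⟩
    have h := aroots_poly_rootCoeff (conjInv_rPair v)
    have hz1 : ‖(⟨v 0, v 1⟩ : ℂ)‖ < 1 := by
      rw [← abs_of_nonneg (norm_nonneg _), ← sq_lt_one_iff_abs_lt_one, Complex.sq_norm,
        Complex.normSq_mk]
      linarith
    refine ⟨?_, ?_⟩
    · intro z hz
      rw [h, map_rPair, Multiset.mem_cons, Multiset.mem_cons, Multiset.map_map] at hz
      rcases hz with rfl | rfl | hz
      · exact hz1
      · rwa [Complex.norm_conj]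
      · obtain ⟨k, -, rfl⟩ := Multiset.mem_map.1 hz
        simpa using hv3 k
    · rw [h, map_rPair, Multiset.filter_cons_of_pos _ (by simpa using hv1.ne'),
        Multiset.filter_cons_of_pos _ (by simpa using hv1.ne'), filter_map_ofReal]
      simp
  · rintro ⟨h1, h2⟩
    set M := (poly a).aroots ℂ with hM
    have hMc : M.map (starRingEnd ℂ) = M := map_conj_aroots _
    set N := M.filter (fun z => z.im ≠ 0) with hN
    have hNc : ∀ z ∈ N, (starRingEnd ℂ) z ∈ N := by
      intro z hz
      rw [hN, Multiset.mem_filter] at hz ⊢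
      refine ⟨?_, by simpa using hz.2⟩
      rw [← hMc]
      exact Multiset.mem_map_of_mem _ hz.1
    obtain ⟨z, w, hzw⟩ := Multiset.card_eq_two.1 (by simpa using h2)
    have hzN : z ∈ N := by rw [hzw]; simp
    have hzim : z.im ≠ 0 := by
      rw [hN] at hzN; exact (Multiset.mem_filter.1 hzN).2
    have hw : w = (starRingEnd ℂ) z := by
      have := hNc z hzN
      rw [hzw] at this
      simp only [Multiset.insert_eq_cons, Multiset.mem_cons, Multiset.mem_singleton] at this
      rcases this with h | h
      · exact absurd (Complex.conj_eq_iff_im.1 h) hzim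
      · exact h.symm
    -- The two nonreal roots are conjugate to each other; the one in the upper half-plane is the
    -- normalized representative.
    have hpos : ∃ u : ℂ, 0 < u.im ∧ N = u ::ₘ (starRingEnd ℂ) u ::ₘ 0 := by
      rcases hzim.lt_or_gt with h | h
      · refine ⟨(starRingEnd ℂ) z, by simpa using h, ?_⟩
        rw [hzw, hw, Complex.conj_conj, Multiset.insert_eq_cons, ← Multiset.cons_zero,
          Multiset.cons_swap]
      · exact ⟨z, h, by rw [hzw, hw]; rfl⟩
    obtain ⟨u, hu, hNu⟩ := hpos
    set R := M.filter (fun z => ¬ z.im ≠ 0) with hR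
    have hNR : N + R = M := Multiset.filter_add_not _ _
    have hRr := exists_ofReal_of_im_eq_zero (M := R) (fun z hz => by
      rw [hR] at hz; exact not_not.1 (Multiset.mem_filter.1 hz).2)
    have hcard : R.card = m := by
      have := congrArg Multiset.card hNR
      rw [Multiset.card_add, hM, card_aroots_poly] at this
      have h2' : N.card = 2 := by simpa using h2
      omega
    obtain ⟨x, hx, hx'⟩ := exists_monotone_map_eq (R.map Complex.re) (m := m)
      (by rw [Multiset.card_map, hcard])
    let v : Fin (m + 2) → ℝ := Matrix.vecCons u.re (Matrix.vecCons u.im x)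
    have hv : M = Finset.univ.val.map (fun k => rPair m k v) := by
      rw [map_rPair, ← hNR, hNu, ← hRr, ← hx']
      simp [v]
    refine ⟨v, ⟨⟨hu, ?_⟩, hx, fun i => ?_⟩, (eq_rootCoeff (conjInv_rPair v) hv).symm⟩
    · have := h1 u (by rw [← hM, ← hNR, hNu]; simp)
      rw [← abs_of_nonneg (norm_nonneg _), ← sq_lt_one_iff_abs_lt_one, Complex.sq_norm,
        Complex.normSq_apply] at this
      change u.re ^ 2 + u.im ^ 2 < 1
      linarith
    · have := h1 (x i) (by
        rw [← hM, ← hNR, ← hRr, ← hx', Multiset.mem_add]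
        right
        rw [Multiset.map_map]
        exact Multiset.mem_map.2 ⟨i, Finset.mem_univ i, rfl⟩)
      simpa [v] using this

theorem injOn_pairDom (m : ℕ) :
    Set.InjOn (fun v => rootCoeff fun k => rPair m k v) (pairDom m) := by
  intro v hv w hw h
  have h1 := aroots_poly_rootCoeff (conjInv_rPair v)
  have h2 := aroots_poly_rootCoeff (conjInv_rPair w)
  simp only at h
  rw [h, h2, map_rPair, map_rPair] at h1
  -- The only root with positive imaginary part recovers `v 0` and `v 1`; the remaining real roots
  -- are recovered from their ordering.
  have hf : ∀ v ∈ pairDom m, ((⟨v 0, v 1⟩ : ℂ) ::ₘ (starRingEnd ℂ) ⟨v 0, v 1⟩ ::ₘ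
      (Finset.univ.val.map fun k : Fin m => v k.succ.succ).map ((↑) : ℝ → ℂ)).filter
        (fun z => 0 < z.im) = {(⟨v 0, v 1⟩ : ℂ)} := by
    intro v hv
    have h0 := hv.1.1
    rw [Multiset.filter_cons_of_pos _ (by exact h0), Multiset.filter_cons_of_neg _ (by
      simpa using h0.le), Multiset.filter_eq_nil.2]
    · rfl
    · intro z hz
      obtain ⟨x, -, rfl⟩ := Multiset.mem_map.1 hz
      simp
  have h3 := congrArg (Multiset.filter (fun z : ℂ => 0 < z.im)) h1
  rw [hf v hv, hf w hw, Multiset.singleton_inj] at h3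
  rw [h3, Multiset.cons_inj_right, Multiset.cons_inj_right] at h1
  have h4 := monotone_eq_of_map_eq hw.2.1 hv.2.1
    (Multiset.map_injective Complex.ofReal_injective h1)
  have h5 := Complex.ext_iff.1 h3
  ext k
  cases k using Fin.cases with
  | zero => exact h5.1.symm
  | succ k =>
    cases k using Fin.cases with
    | zero => exact h5.2.symm
    | succ k => exact (congrFun h4 k).symm

/-! ### The volumes as integrals over cubes -/

theorem vdm_ofReal {m : ℕ} (x : Fin m → ℝ) :
    vdm (fun k => ((x k : ℝ) : ℂ)) = ((vdm x : ℝ) : ℂ) := by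
  simp only [vdm]
  push_cast
  rfl

theorem vol_zero_eq (d : ℕ) :
    vol d 0 = ∫⁻ v in monoBox d, ENNReal.ofReal |vdm v| := by
  rw [vol, ← image_monoBox, volume_image_rootCoeff (rReal d) conjInv_rReal
    (measurableSet_monoBox d) (injOn_monoBox d)]
  · have : (Matrix.of fun k j => rReal d k (Pi.single j 1)) = 1 := by
      ext k j
      rw [Matrix.of_apply, rReal_apply, Matrix.one_apply, Pi.single_apply]
      split_ifs <;> simp
    rw [this]
    simp only [Matrix.det_one, norm_one, one_mul, rReal_apply, vdm_ofReal,
      Complex.norm_real, Real.norm_eq_abs]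
  · filter_upwards [ae_injective_volume d] with v hv _
    exact Complex.ofReal_injective.comp hv

/-- The matrix is block diagonal with blocks `[[1, i], [1, -i]]`, of determinant `-2i`, and the
identity. -/
theorem norm_det_rPair (m : ℕ) :
    ‖(Matrix.of fun k j => rPair m k (Pi.single j 1)).det‖ = 2 := by
  have h1 : ∀ j : Fin m, (1 : Fin (m + 2)) ≠ j.succ.succ := fun j hj => by
    simp [Fin.ext_iff] at hj
  have h : ∀ k j, rPair m k (Pi.single j 1) = Matrix.vecCons
      (Matrix.vecCons 1 (Matrix.vecCons Complex.I 0))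
      (Matrix.vecCons (Matrix.vecCons 1 (Matrix.vecCons (-Complex.I) 0))
        fun k : Fin m => fun j : Fin (m + 2) => if j = k.succ.succ then (1 : ℂ) else 0) k j := by
    intro k j
    cases k using Fin.cases with
    | zero =>
      cases j using Fin.cases with
      | zero => simp [rPair, rReal_apply]
      | succ j =>
        cases j using Fin.cases with
        | zero => simp [rPair, rReal_apply]
        | succ j => simp [rPair, rReal_apply, h1]
    | succ k =>
      cases k using Fin.cases with
      | zero =>
        cases j using Fin.cases with
        | zero => simp [rPair, rReal_apply]
        | succ j =>
          cases j using Fin.cases with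
          | zero => simp [rPair, rReal_apply]
          | succ j => simp [rPair, rReal_apply, h1]
      | succ k =>
        simp only [rPair, rReal_apply, Matrix.cons_val_succ, Pi.single_apply, eq_comm]
        split_ifs <;> simp
  simp only [h]
  rw [Matrix.det_succ_row_zero, Fin.sum_univ_succ, Fin.sum_univ_succ, Finset.sum_eq_zero]
  · have d1 : (Matrix.submatrix (Matrix.of fun k j => Matrix.vecCons
      (Matrix.vecCons 1 (Matrix.vecCons Complex.I 0))
      (Matrix.vecCons (Matrix.vecCons 1 (Matrix.vecCons (-Complex.I) 0))
        fun k : Fin m => fun j : Fin (m + 2) => if j = k.succ.succ then (1 : ℂ) else 0) k j)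
        Fin.succ (Fin.succAbove 0)) = Matrix.diagonal (Matrix.vecCons (-Complex.I) 1) := by
      ext k j
      cases k using Fin.cases with
      | zero => cases j using Fin.cases <;> simp [(Fin.succ_ne_zero _).symm]
      | succ k =>
        cases j using Fin.cases with
        | zero => simp [Fin.ext_iff]
        | succ j => simp [Matrix.diagonal_apply, eq_comm]
    have d2 : (Matrix.submatrix (Matrix.of fun k j => Matrix.vecCons
      (Matrix.vecCons 1 (Matrix.vecCons Complex.I 0))
      (Matrix.vecCons (Matrix.vecCons 1 (Matrix.vecCons (-Complex.I) 0))
        fun k : Fin m => fun j : Fin (m + 2) => if j = k.succ.succ then (1 : ℂ) else 0) k j)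
        Fin.succ (Fin.succAbove (Fin.succ 0))) = Matrix.diagonal (Matrix.vecCons 1 1) := by
      ext k j
      cases k using Fin.cases with
      | zero => cases j using Fin.cases <;> simp [(Fin.succ_ne_zero _).symm]
      | succ k =>
        cases j using Fin.cases with
        | zero => simp [Fin.ext_iff]
        | succ j => simp [Matrix.diagonal_apply, eq_comm]
    rw [d1, d2, Matrix.det_diagonal, Matrix.det_diagonal]
    simp [Fin.prod_univ_succ]
    rw [show -Complex.I + -Complex.I = (-2 : ℝ) * Complex.I by push_cast; ring]
    simp
  · intro j _
    simp

theorem vol_one_eq (m : ℕ) : vol (m + 2) 1 =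
    ∫⁻ v in pairDom m, ENNReal.ofReal (2 * ‖vdm fun k => rPair m k v‖) := by
  rw [vol, ← image_pairDom, volume_image_rootCoeff (rPair m) conjInv_rPair
    (measurableSet_pairDom m) (injOn_pairDom m)]
  · simp only [norm_det_rPair]
  · filter_upwards [ae_injective_volume (m + 2)] with v hv hD
    have h0 := hD.1.1
    rw [rPair_eq]
    have hx : Function.Injective fun k : Fin m => (v k.succ.succ : ℂ) := fun i j hij =>
      Fin.succ_injective _ (Fin.succ_injective _ (hv (Complex.ofReal_injective hij)))
    have h1 : Function.Injective (Matrix.vecCons ((starRingEnd ℂ) (⟨v 0, v 1⟩ : ℂ))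
        fun k : Fin m => (v k.succ.succ : ℂ)) := by
      refine Fin.cons_injective_iff.2 ⟨?_, hx⟩
      rintro ⟨k, hk⟩
      have := congrArg Complex.im hk
      simp at this
      exact h0.ne' this
    refine Fin.cons_injective_iff.2 ⟨?_, h1⟩
    rintro ⟨k, hk⟩
    have := congrArg Complex.im hk
    cases k using Fin.cases with
    | zero => simp at this; linarith
    | succ k => simp at this; exact h0.ne this

/-- Almost every point has distinct coordinates and is sorted by exactly one permutation, so the
cube splits into `m!` congruent pieces up to null sets. -/
theorem lintegral_cube_eq {m : ℕ} (f : (Fin m → ℝ) → ℝ≥0∞) (hf : Measurable f)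
    (hs : ∀ (σ : Equiv.Perm (Fin m)) x, f (x ∘ σ) = f x) :
    ∫⁻ x, f x ∂cube m = m.factorial * ∫⁻ x in monoBox m, f x := by
  classical
  have h1 : ∀ᵐ x ∂cube m, f x =
      ∑ σ : Equiv.Perm (Fin m), {y : Fin m → ℝ | Monotone y}.indicator f (x ∘ σ) := by
    filter_upwards [ae_injective_cube m] with x hx
    rw [Finset.sum_eq_single (Tuple.sort x)]
    · rw [Set.indicator_of_mem (show x ∘ Tuple.sort x ∈ {y : Fin m → ℝ | Monotone y} from
        Tuple.monotone_sort x), hs]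
    · intro σ _ hσ
      refine Set.indicator_of_notMem (fun h => hσ ?_) _
      have := Tuple.unique_monotone h (Tuple.monotone_sort x)
      ext i
      exact congrArg Fin.val (hx (congrFun this i))
    · simp
  have h2 : ∀ σ : Equiv.Perm (Fin m), ∫⁻ x, {y : Fin m → ℝ | Monotone y}.indicator f (x ∘ σ)
      ∂cube m = ∫⁻ x in {y : Fin m → ℝ | Monotone y}, f x ∂cube m := by
    intro σ
    have h := measurePreserving_arrowCongr' (fun _ : Fin m => seg) (fun _ : Fin m => seg) σ.symm
      (MeasurableEquiv.refl ℝ) (fun _ => MeasurePreserving.id _)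
    rw [← lintegral_indicator (measurableSet_monotone m)]
    exact h.lintegral_comp_emb (MeasurableEquiv.measurableEmbedding _) _
  have h3 : ∀ σ : Equiv.Perm (Fin m),
      Measurable fun x : Fin m → ℝ => {y : Fin m → ℝ | Monotone y}.indicator f (x ∘ σ) :=
    fun σ => (hf.indicator (measurableSet_monotone m)).comp
      (measurable_pi_lambda _ fun i => measurable_pi_apply _)
  rw [lintegral_congr_ae h1, lintegral_finsetSum _ fun σ _ => h3 σ]
  simp only [h2, Finset.sum_const, Finset.card_univ, Fintype.card_perm, Fintype.card_fin,
    nsmul_eq_mul]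
  congr 1
  have h4 : cube m = volume.restrict (Set.univ.pi fun _ : Fin m => Set.Ioo (-1 : ℝ) 1) := by
    have : seg = volume.restrict (Set.Ioo (-1 : ℝ) 1) :=
      Measure.restrict_congr_set Ioo_ae_eq_Ioc.symm
    rw [cube, this]
    exact (Measure.restrict_pi_pi (fun _ : Fin m => (volume : Measure ℝ)) _).symm
  rw [h4, Measure.restrict_restrict (measurableSet_monotone m)]
  congr 2
  ext x
  simp [monoBox, abs_lt]

/-! ### Determinants of Legendre polynomials -/

theorem coeff_fleg_pos (n : ℕ) : 0 < (fleg n).coeff n := by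
  rw [fleg, coeff_C_mul]
  have := coeff_leg_pos n
  positivity

theorem natDegree_fleg (n : ℕ) : (fleg n).natDegree = n := by
  refine le_antisymm ?_ (le_natDegree_of_ne_zero (coeff_fleg_pos n).ne')
  exact (natDegree_C_mul_le _ _).trans (natDegree_leg_le n)

/-- The ratio of the determinant of `fleg 0, …, fleg (d - 1)` to the product of differences. -/
noncomputable def flegDet (d : ℕ) : ℝ :=
  (∏ j : Fin d, (fleg j).coeff j) * ∏ j : Fin d, (-1 : ℝ) ^ (j : ℕ)

theorem flegDet_ne_zero (d : ℕ) : flegDet d ≠ 0 :=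
  mul_ne_zero (Finset.prod_ne_zero_iff.2 fun j _ => (coeff_fleg_pos j).ne')
    (Finset.prod_ne_zero_iff.2 fun j _ => pow_ne_zero _ (by norm_num))

/-- Dividing each column by its leading coefficient leaves monic polynomials of degrees `0, ..., d -
1`, whose determinant is Vandermonde's. The signs in `flegDet` arise because `vdm` uses `x i - x j`
for `i < j`. -/
theorem det_aeval_fleg {R : Type*} [CommRing R] [Nontrivial R] [Algebra ℝ R] {d : ℕ}
    (y : Fin d → R) :
    (Matrix.of fun i j : Fin d => aeval (y i) (fleg j)).det = algebraMap ℝ R (flegDet d) * vdm y := by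
  let p : Fin d → ℝ[X] := fun j => C ((fleg j).coeff j)⁻¹ * fleg j
  have hdeg : ∀ j, (p j).natDegree = j := fun j => by
    rw [natDegree_C_mul (inv_ne_zero (coeff_fleg_pos j).ne'), natDegree_fleg]
  have hmon : ∀ j, (p j).Monic := fun j => by
    rw [Monic, leadingCoeff, hdeg, coeff_C_mul, inv_mul_cancel₀ (coeff_fleg_pos j).ne']
  have h1 := Matrix.det_eval_matrixOfPolynomials_eq_det_vandermonde y
    (fun j => (p j).map (algebraMap ℝ R)) (fun j => by rw [(hmon j).natDegree_map, hdeg])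
    (fun j => (hmon j).map _)
  have h2 : (Matrix.of fun i j : Fin d => aeval (y i) (fleg j)) = Matrix.of fun i (j : Fin d) =>
      algebraMap ℝ R ((fleg j).coeff j) *
        (Matrix.of fun i j : Fin d => ((p j).map (algebraMap ℝ R)).eval (y i)) i j := by
    ext i j
    simp only [Matrix.of_apply, p, ← eval_map_algebraMap, Polynomial.map_mul, eval_mul, map_C,
      eval_C, ← mul_assoc, ← map_mul, mul_inv_cancel₀ (coeff_fleg_pos j).ne', map_one, one_mul]
  have h3 : Matrix.vandermonde (fun i => -y i) = Matrix.of fun i (j : Fin d) =>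
      algebraMap ℝ R ((-1) ^ (j : ℕ)) * Matrix.vandermonde y i j := by
    ext i j
    rw [Matrix.of_apply, Matrix.vandermonde_apply, Matrix.vandermonde_apply, neg_pow]
    simp
  rw [h2, Matrix.det_mul_row, ← h1, vdm_eq_det, h3, Matrix.det_mul_row, ← mul_assoc, flegDet,
    ← map_prod, ← map_prod, ← map_mul, mul_assoc, ← Finset.prod_mul_distrib]
  simp [← pow_add, ← two_mul]

/-- The vectors of the standard basis of `ℝ ^ d`, followed by zeros. -/
def stdVec (d : ℕ) (j : ℕ) : Fin d → ℝ := fun i => if (i : ℕ) = j then 1 else 0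

theorem comb_stdVec (d : ℕ) (c : ℕ → ℝ) : comb (stdVec d) d c = fun i : Fin d => c i := by
  ext i
  simp [comb, stdVec]

theorem rho_stdVec (d : ℕ) (x : ℝ) : rho (stdVec d) d x = fun i : Fin d => (fleg i).eval x :=
  comb_stdVec d fun j => (fleg j).eval x

theorem detRowAlternating_rho (d : ℕ) (x : Fin d → ℝ) :
    Matrix.detRowAlternating (fun i => rho (stdVec d) d (x i)) = flegDet d * vdm x := by
  have h := det_aeval_fleg x
  simp only [rho_stdVec, Algebra.algebraMap_self, RingHom.id_apply, coe_aeval_eq_eval] at h ⊢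
  exact h

/-- The volume of the contractive polynomials all of whose roots are real. -/
noncomputable def realVol (d : ℕ) : ℝ :=
  Matrix.detRowAlternating (revv (stdVec d) d) / flegDet d

theorem realVol_ne_zero (d : ℕ) : realVol d ≠ 0 := by
  refine div_ne_zero ?_ (flegDet_ne_zero d)
  have : revv (stdVec d) d = (1 : Matrix (Fin d) (Fin d) ℝ).submatrix Fin.revPerm id := by
    ext i j
    simp only [revv, stdVec, Matrix.submatrix_apply, Matrix.one_apply, Fin.revPerm_apply,
      Fin.ext_iff, Fin.val_rev, id, eq_comm (a := (j : ℕ))]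
    congr 2
    omega
  rw [this]
  change Matrix.det _ ≠ 0
  rw [Matrix.det_permute, Matrix.det_one, mul_one]
  simp

/-- This is `pf_self` for the determinant and the standard basis: the sign in `pf` turns the
Vandermonde product into its absolute value. -/
theorem integral_abs_vdm (d : ℕ) : ∫ x, |vdm x| ∂cube d = d.factorial * realVol d := by
  have h := pf_self (stdVec d) d Matrix.detRowAlternating
  simp only [pf, detRowAlternating_rho, mul_left_comm _ (flegDet d), sgn_mul_eq_abs] at h
  rw [integral_const_mul] at h
  rw [realVol, ← mul_div_assoc, ← h, mul_div_cancel_left₀ _ (flegDet_ne_zero d)]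

/-- Nonnegativity comes from the integral and nonvanishing from the determinants, so the signs of
the latter need not be determined. -/
theorem realVol_pos (d : ℕ) : 0 < realVol d := by
  refine lt_of_le_of_ne ?_ (realVol_ne_zero d).symm
  have h : 0 ≤ ∫ x, |vdm x| ∂cube d := integral_nonneg fun x => abs_nonneg _
  rw [integral_abs_vdm] at h
  exact nonneg_of_mul_nonneg_right h (by positivity)

theorem lintegral_monoBox_eq {m : ℕ} {g : (Fin m → ℝ) → ℝ} {c : ℝ}
    (hg : Continuous g) (h0 : ∀ x, 0 ≤ g x) (hs : ∀ (σ : Equiv.Perm (Fin m)) x, g (x ∘ σ) = g x)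
    (hc : ∫ x, g x ∂cube m = m.factorial * c) :
    ∫⁻ x in monoBox m, ENNReal.ofReal (g x) = ENNReal.ofReal c := by
  have h := lintegral_cube_eq (fun x => ENNReal.ofReal (g x)) hg.measurable.ennreal_ofReal
    fun σ x => by rw [hs]
  rw [← ofReal_integral_eq_lintegral_ofReal (integrable_cube hg)
    (Filter.Eventually.of_forall h0), hc, ENNReal.ofReal_mul (by positivity),
    ENNReal.ofReal_natCast] at h
  exact ((ENNReal.mul_right_inj (by exact_mod_cast m.factorial_ne_zero)
    (ENNReal.natCast_ne_top _)).1 h).symm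

theorem abs_vdm_comp_perm {m : ℕ} (x : Fin m → ℝ) (σ : Equiv.Perm (Fin m)) :
    |vdm (x ∘ σ)| = |vdm x| := by
  rw [vdm_comp_perm, abs_mul]
  rcases Int.units_eq_one_or (Equiv.Perm.sign σ) with h | h <;> simp [h]

theorem vol_zero (d : ℕ) : vol d 0 = ENNReal.ofReal (realVol d) := by
  rw [vol_zero_eq]
  exact lintegral_monoBox_eq (continuous_vdm d).abs (fun _ => abs_nonneg _)
    (fun σ x => abs_vdm_comp_perm x σ) (integral_abs_vdm d)

/-! ### The volume for one conjugate pair -/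

theorem vdm_pair {m : ℕ} (z : ℂ) (x : Fin m → ℝ) :
    vdm (Matrix.vecCons z (Matrix.vecCons ((starRingEnd ℂ) z) fun k => ((x k : ℝ) : ℂ))) =
      2 * Complex.I * ((z.im * (∏ k, Complex.normSq (z - x k)) * vdm x : ℝ) : ℂ) := by
  rw [vdm_vecCons, vdm_vecCons, vdm_ofReal, Fin.prod_univ_succ]
  simp only [Matrix.cons_val_zero, Matrix.cons_val_succ]
  have h : (∏ k, (z - x k)) * ∏ k, ((starRingEnd ℂ) z - x k) =
      ((∏ k, Complex.normSq (z - x k) : ℝ) : ℂ) := by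
    rw [← Finset.prod_mul_distrib, Complex.ofReal_prod]
    refine Finset.prod_congr rfl fun k _ => ?_
    rw [Complex.normSq_eq_conj_mul_self, map_sub, Complex.conj_ofReal, mul_comm]
  rw [Complex.sub_conj]
  push_cast at h ⊢
  linear_combination (2 * z.im * Complex.I * vdm x : ℂ) * h

/-- The rows at `z` and `conj z` are `Re ± i Im`. By alternation they contribute `2i` times the form
at `(Im, Re)`, in this order, and `2i` is also the factor in `vdm_pair`; cancelling it leaves a real
identity. -/
theorem det_fleg_pair {m : ℕ} (a b : ℝ) (x : Fin m → ℝ) :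
    ((Matrix.detRowAlternating.curryLeft (comb (stdVec (m + 2)) (m + 2) (imC a b))).curryLeft
      (comb (stdVec (m + 2)) (m + 2) (reC a b))) (fun i => rho (stdVec (m + 2)) (m + 2) (x i)) =
      flegDet (m + 2) * (b * (∏ k, Complex.normSq (⟨a, b⟩ - x k)) * vdm x) := by
  let F : ℂ → Fin (m + 2) → ℂ := fun z j => aeval z (fleg j)
  let Re : Fin (m + 2) → ℂ := fun j => (reC a b j : ℂ)
  let Im : Fin (m + 2) → ℂ := fun j => (imC a b j : ℂ)
  let Φ : (Fin (m + 2) → ℂ) [⋀^Fin (m + 2)]→ₗ[ℂ] ℂ := Matrix.detRowAlternating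
  have h1 := det_aeval_fleg (Matrix.vecCons (⟨a, b⟩ : ℂ)
    (Matrix.vecCons ((starRingEnd ℂ) ⟨a, b⟩) fun k => ((x k : ℝ) : ℂ)))
  rw [vdm_pair] at h1
  have h2 : (Matrix.of fun i j : Fin (m + 2) => aeval (Matrix.vecCons (⟨a, b⟩ : ℂ)
      (Matrix.vecCons ((starRingEnd ℂ) ⟨a, b⟩) fun k => ((x k : ℝ) : ℂ)) i) (fleg j)).det =
      ((Φ.curryLeft (Re + Complex.I • Im)).curryLeft (Re + (-Complex.I) • Im))
        fun k => F (x k) := by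
    have hF : F ⟨a, b⟩ = Re + Complex.I • Im := by
      ext j
      simp only [F, Re, Im, reC, imC, Pi.add_apply, Pi.smul_apply, smul_eq_mul]
      rw [mul_comm, Complex.re_add_im]
    have hF' : F ((starRingEnd ℂ) ⟨a, b⟩) = Re + (-Complex.I) • Im := by
      ext j
      simp only [F, Re, Im, reC, imC, Pi.add_apply, Pi.smul_apply, smul_eq_mul]
      rw [aeval_conj]
      apply Complex.ext <;> simp
    rw [← hF, ← hF', AlternatingMap.curryLeft_apply_apply, AlternatingMap.curryLeft_apply_apply,
      ← comp_vecCons F, ← comp_vecCons F]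
    rfl
  have h3 : ((Φ.curryLeft (Re + Complex.I • Im)).curryLeft (Re + (-Complex.I) • Im)) =
      (2 * Complex.I) • ((Φ.curryLeft Im).curryLeft Re) := by
    simp only [map_add, map_smul, AlternatingMap.curryLeft_add, AlternatingMap.curryLeft_smul,
      LinearMap.add_apply, LinearMap.smul_apply, AlternatingMap.curryLeft_same]
    rw [curryLeft_swap Φ Re Im]
    module
  have h4 : ((Φ.curryLeft Im).curryLeft Re) (fun k => F (x k)) =
      ((((Matrix.detRowAlternating.curryLeft (comb (stdVec (m + 2)) (m + 2) (imC a b))).curryLeft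
        (comb (stdVec (m + 2)) (m + 2) (reC a b)))
          (fun i => rho (stdVec (m + 2)) (m + 2) (x i)) : ℝ) : ℂ) := by
    simp only [AlternatingMap.curryLeft_apply_apply, comb_stdVec, rho_stdVec]
    refine Eq.trans ?_ (Complex.ofRealHom.map_det _).symm
    change Matrix.det _ = _
    congr 1
    ext k j
    cases k using Fin.cases with
    | zero => rfl
    | succ k =>
      cases k using Fin.cases with
      | zero => rfl
      | succ k =>
        change aeval ((algebraMap ℝ ℂ) (x k)) (fleg j) = _
        rw [aeval_algebraMap_apply, coe_aeval_eq_eval]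
        rfl
  rw [h2, h3, AlternatingMap.smul_apply, h4, smul_eq_mul, mul_left_comm,
    Complex.coe_algebraMap] at h1
  have h5 := mul_left_cancel₀ (by simp) h1
  exact_mod_cast h5

theorem norm_vdm_rPair {m : ℕ} (v : Fin (m + 2) → ℝ) (hb : 0 < v 1) :
    ‖vdm fun k => rPair m k v‖ = 2 * (v 1 * (∏ k : Fin m, Complex.normSq (⟨v 0, v 1⟩ - v k.succ.succ)) *
      |vdm fun k : Fin m => v k.succ.succ|) := by
  rw [rPair_eq, vdm_pair, norm_mul, Complex.norm_real, Real.norm_eq_abs, abs_mul, abs_of_nonneg]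
  · simp
  · exact mul_nonneg hb.le (Finset.prod_nonneg fun _ _ => Complex.normSq_nonneg _)

/-- The integral over the real roots for a fixed pair `a ± ib`. The factor `4` combines the
determinant `2` of the parametrization with `|z - conj z| = 2b`. Nonnegativity is recorded because
`ENNReal.ofReal` truncates. -/
theorem lintegral_monoBox_pair {m : ℕ} (a b : ℝ) (hb : 0 < b) :
    ∫⁻ x in monoBox m, ENNReal.ofReal (4 * (b * (∏ k, Complex.normSq (⟨a, b⟩ - x k)) * |vdm x|)) =
      ENNReal.ofReal (4 * altPair (imC a b) (reC a b) m * realVol (m + 2)) ∧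
    0 ≤ 4 * altPair (imC a b) (reC a b) m * realVol (m + 2) := by
  have h0 : ∀ x : Fin m → ℝ, 0 ≤ 4 * (b * (∏ k, Complex.normSq (⟨a, b⟩ - x k)) * |vdm x|) :=
    fun x => by
      have : 0 ≤ ∏ k, Complex.normSq (⟨a, b⟩ - x k) :=
        Finset.prod_nonneg fun _ _ => Complex.normSq_nonneg _
      positivity
  have hc : ∫ x, 4 * (b * (∏ k, Complex.normSq (⟨a, b⟩ - x k)) * |vdm x|) ∂cube m =
      m.factorial * (4 * altPair (imC a b) (reC a b) m * realVol (m + 2)) := by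
    have h := pf_curryLeft_comb_comb (stdVec (m + 2)) m (imC a b) (reC a b)
      Matrix.detRowAlternating
    simp only [pf, det_fleg_pair] at h
    have h1 : ∀ x : Fin m → ℝ, 4 * (b * (∏ k, Complex.normSq (⟨a, b⟩ - x k)) * |vdm x|) =
        4 / flegDet (m + 2) * (sgn (vdm x) * (flegDet (m + 2) *
          (b * (∏ k, Complex.normSq (⟨a, b⟩ - x k)) * vdm x))) := by
      intro x
      rw [← sgn_mul_eq_abs]
      field_simp [flegDet_ne_zero (m + 2)]
    simp only [h1]
    rw [integral_const_mul, h, realVol]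
    ring
  refine ⟨lintegral_monoBox_eq ?_ h0 ?_ hc, ?_⟩
  · have := continuous_vdm m
    have h2 : Continuous fun x : Fin m → ℝ => ∏ k, Complex.normSq (⟨a, b⟩ - x k) :=
      continuous_finsetProd _ fun k _ => Complex.continuous_normSq.comp
        (continuous_const.sub (Complex.continuous_ofReal.comp (continuous_apply k)))
    fun_prop
  · intro σ x
    rw [abs_vdm_comp_perm]
    congr 3
    exact Equiv.prod_comp σ fun k => Complex.normSq (⟨a, b⟩ - x k)
  · have h : 0 ≤ ∫ x, 4 * (b * (∏ k, Complex.normSq (⟨a, b⟩ - x k)) * |vdm x|) ∂cube m :=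
      integral_nonneg h0
    rw [hc] at h
    exact nonneg_of_mul_nonneg_right h (by positivity)

theorem lintegral_fin_succ {m : ℕ} {f : (Fin (m + 1) → ℝ) → ℝ≥0∞} (hf : Measurable f) :
    ∫⁻ x, f x = ∫⁻ t, ∫⁻ w, f (Matrix.vecCons t w) := by
  have hp := (volume_preserving_piFinSuccAbove (fun _ : Fin (m + 1) => ℝ) 0).symm
  rw [← hp.lintegral_comp_emb (MeasurableEquiv.measurableEmbedding _),
    Measure.volume_eq_prod]
  refine (lintegral_prod _ (hf.comp (MeasurableEquiv.measurable _)).aemeasurable).trans ?_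
  refine lintegral_congr fun t => lintegral_congr fun w => ?_
  simp only [MeasurableEquiv.piFinSuccAbove_symm_apply, Fin.insertNthEquiv]
  simp
  rfl

theorem continuous_norm_vdm_rPair (m : ℕ) :
    Continuous fun v : Fin (m + 2) → ℝ => 2 * ‖vdm fun k => rPair m k v‖ := by
  unfold vdm
  fun_prop

theorem lintegral_pairDom (m : ℕ) (a b : ℝ) :
    ∫⁻ x : Fin m → ℝ, (pairDom m).indicator (fun v => ENNReal.ofReal
      (2 * ‖vdm fun k => rPair m k v‖)) (Matrix.vecCons a (Matrix.vecCons b x)) =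
    (Set.Ioo 0 √(1 - a ^ 2)).indicator (fun b => ENNReal.ofReal
      (4 * altPair (imC a b) (reC a b) m * realVol (m + 2))) b := by
  have hmem : b ∈ Set.Ioo 0 √(1 - a ^ 2) ↔ 0 < b ∧ a ^ 2 + b ^ 2 < 1 := by
    rw [Set.mem_Ioo]
    refine and_congr_right fun hb => ?_
    rw [Real.lt_sqrt hb.le]
    constructor <;> intro h <;> linarith
  by_cases h : 0 < b ∧ a ^ 2 + b ^ 2 < 1
  · rw [Set.indicator_of_mem (hmem.2 h), ← (lintegral_monoBox_pair a b h.1).1,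
      ← lintegral_indicator (measurableSet_monoBox m)]
    refine lintegral_congr fun x => ?_
    by_cases hx : x ∈ monoBox m
    · rw [Set.indicator_of_mem hx, Set.indicator_of_mem (show _ ∈ pairDom m from ⟨h, hx⟩),
        norm_vdm_rPair _ (by exact h.1)]
      congr 1
      simp only [Matrix.cons_val_zero, Matrix.cons_val_one, Matrix.cons_val_succ]
      ring
    · rw [Set.indicator_of_notMem hx, Set.indicator_of_notMem fun h' => hx h'.2]
  · rw [Set.indicator_of_notMem fun h' => h (hmem.1 h')]
    rw [← lintegral_zero (μ := (volume : Measure (Fin m → ℝ)))]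
    refine lintegral_congr fun x => Set.indicator_of_notMem (fun h' => h h'.1) _

theorem vol_one (m : ℕ) : vol (m + 2) 1 = ENNReal.ofReal
    (realVol (m + 2) * (((leg (m + 2)).eval 3 - 2 * (m + 2) - 1) / 4)) ∧
    0 ≤ realVol (m + 2) * (((leg (m + 2)).eval 3 - 2 * (m + 2) - 1) / 4) := by
  obtain ⟨f, hf, h1, h2⟩ := exists_integral_altPair m
  have hmeas : Measurable ((pairDom m).indicator fun v => ENNReal.ofReal
      (2 * ‖vdm fun k => rPair m k v‖)) :=
    (continuous_norm_vdm_rPair m).measurable.ennreal_ofReal.indicator (measurableSet_pairDom m)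
  have hcons : ∀ a, Measurable fun w : Fin (m + 1) → ℝ => (Matrix.vecCons a w : Fin (m + 2) → ℝ) :=
    fun a => measurable_pi_lambda _ fun k => by
      cases k using Fin.cases with
      | zero => exact measurable_const
      | succ k => exact measurable_pi_apply k
  have h3 : ∀ a, ∫⁻ b in Set.Ioo 0 √(1 - a ^ 2), ENNReal.ofReal
      (4 * altPair (imC a b) (reC a b) m * realVol (m + 2)) = ENNReal.ofReal (realVol (m + 2) * f a) ∧
      0 ≤ realVol (m + 2) * f a := by
    intro a
    have hc : Continuous fun b => 4 * altPair (imC a b) (reC a b) m * realVol (m + 2) :=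
      (continuous_const.mul (continuous_altPair
        (fun j => (continuous_imC j).comp (f := fun y : ℝ => (a, y)) (by fun_prop))
        (fun j => (continuous_reC j).comp (f := fun y : ℝ => (a, y)) (by fun_prop)) m)).mul
        continuous_const
    have hi : ∫ b in Set.Ioo 0 √(1 - a ^ 2), 4 * altPair (imC a b) (reC a b) m * realVol (m + 2) =
        realVol (m + 2) * f a := by
      rw [← integral_Ioc_eq_integral_Ioo, ← intervalIntegral.integral_of_le (Real.sqrt_nonneg _),
        intervalIntegral.integral_mul_const, h1, mul_comm]
    have hpos : ∀ᵐ b ∂volume.restrict (Set.Ioo 0 √(1 - a ^ 2)),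
        0 ≤ 4 * altPair (imC a b) (reC a b) m * realVol (m + 2) := by
      filter_upwards [ae_restrict_mem measurableSet_Ioo] with b hb
      exact (lintegral_monoBox_pair a b hb.1).2
    rw [← hi, ofReal_integral_eq_lintegral_ofReal
      (hc.integrableOn_Icc.mono_set Set.Ioo_subset_Icc_self) hpos]
    exact ⟨rfl, integral_nonneg_of_ae hpos⟩
  -- Here `1 - a ^ 2 ≤ 0`, so its square root is `0` by convention and the inner integral runs over
  -- a degenerate interval; the outer integral over the line thus reduces to the segment.
  have h4 : ∀ a, a ∉ Set.Ioc (-1 : ℝ) 1 → f a = 0 := by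
    intro a ha
    have : √(1 - a ^ 2) = 0 := by
      apply Real.sqrt_eq_zero_of_nonpos
      rw [Set.mem_Ioc, not_and_or, not_lt, not_le] at ha
      rcases ha with ha | ha <;> nlinarith
    rw [← h1, this, intervalIntegral.integral_same]
  have h6 : ∫ a in Set.Ioc (-1 : ℝ) 1, realVol (m + 2) * f a =
      realVol (m + 2) * (((leg (m + 2)).eval 3 - 2 * (m + 2) - 1) / 4) := by
    rw [integral_const_mul, ← intervalIntegral.integral_of_le (by norm_num), h2]
  rw [← h6]
  refine ⟨?_, integral_nonneg fun a => (h3 a).2⟩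
  rw [vol_one_eq, ← lintegral_indicator (measurableSet_pairDom m), lintegral_fin_succ hmeas]
  have h5 : ∀ a : ℝ, ∫⁻ w, (pairDom m).indicator (fun v => ENNReal.ofReal
      (2 * ‖vdm fun k => rPair m k v‖)) (Matrix.vecCons a w) = ENNReal.ofReal (realVol (m + 2) * f a) := by
    intro a
    refine (lintegral_fin_succ (hmeas.comp (hcons a))).trans ?_
    simp only [Function.comp_apply, lintegral_pairDom]
    rw [lintegral_indicator measurableSet_Ioo, (h3 a).1]
  simp only [h5]
  rw [← setLIntegral_eq_of_support_subset (s := Set.Ioc (-1 : ℝ) 1),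
    ← ofReal_integral_eq_lintegral_ofReal (f := fun a => realVol (m + 2) * f a)
      ((continuous_const.mul hf).integrableOn_Icc.mono_set Set.Ioc_subset_Icc_self) (Filter.Eventually.of_forall fun a => (h3 a).2)]
  · intro a ha
    by_contra h
    exact ha (by simp [h4 a h])

theorem vol_one_of_lt {d : ℕ} (h : d < 2) : vol d 1 = 0 := by
  have : regionPairs d 1 = ∅ := by
    refine Set.eq_empty_of_forall_notMem fun a ha => ?_
    have h1 := Multiset.card_le_card
      (Multiset.filter_le (fun z : ℂ => z.im ≠ 0) ((poly a).aroots ℂ))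
    rw [ha.2, card_aroots_poly] at h1
    omega
  rw [vol, this, measure_empty]

/-! ### The closed form of the ratio and the recurrence -/

theorem ratio_eq (d : ℕ) : ratio d = ((leg d).eval 3 - 2 * d - 1) / 4 := by
  rcases lt_or_ge d 2 with h | h
  · rw [ratio, vol_one_of_lt h]
    -- There is no room for a pair, and the closed form also vanishes, since `P_0(3) = 1` and
    -- `P_1(3) = 3`.
    interval_cases d
    · simp [leg_zero]
    · norm_num [leg_one]
  · obtain ⟨m, rfl⟩ := Nat.exists_eq_add_of_le' h
    have hV := realVol_pos (m + 2)
    rw [ratio, (vol_one m).1, vol_zero, ENNReal.toReal_ofReal (vol_one m).2, ENNReal.toReal_ofReal hV.le,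
      mul_div_cancel_left₀ _ hV.ne']
    push_cast
    ring

end ContractivePoly

theorem mainTheorem2 :
    (∀ d : ℕ, 0 < ContractivePoly.vol d 0 ∧ ContractivePoly.vol d 0 < ⊤ ∧
      ContractivePoly.vol d 1 < ⊤) ∧
    ContractivePoly.ratio 0 = 0 ∧ ContractivePoly.ratio 1 = 0 ∧
    ∀ d : ℕ, 2 ≤ d →
      (d : ℝ) * ContractivePoly.ratio d
        - 3 * (2 * (d : ℝ) - 1) * ContractivePoly.ratio (d - 1)
        + ((d : ℝ) - 1) * ContractivePoly.ratio (d - 2)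
      = 2 * (d : ℝ) * ((d : ℝ) - 1) := by
  refine ⟨fun d => ⟨?_, ?_, ?_⟩, ?_, ?_, fun d hd => ?_⟩
  · rw [ContractivePoly.vol_zero]
    exact ENNReal.ofReal_pos.2 (ContractivePoly.realVol_pos d)
  · rw [ContractivePoly.vol_zero]
    exact ENNReal.ofReal_lt_top
  · rcases lt_or_ge d 2 with h | h
    · rw [ContractivePoly.vol_one_of_lt h]
      exact ENNReal.zero_lt_top
    · obtain ⟨m, rfl⟩ := Nat.exists_eq_add_of_le' h
      rw [(ContractivePoly.vol_one m).1]
      exact ENNReal.ofReal_lt_top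
  · simp [ContractivePoly.ratio_eq, ContractivePoly.leg_zero]
  · norm_num [ContractivePoly.ratio_eq, ContractivePoly.leg_one]
  · obtain ⟨m, rfl⟩ := Nat.exists_eq_add_of_le' hd
    -- At `3` the Legendre recurrence is the homogeneous form of the claim; the terms `-(2d + 1) /
    -- 4` of the closed form contribute `8 d (d - 1) / 4`.
    have h := congrArg (Polynomial.eval 3) (ContractivePoly.leg_rec m)
    rw [show m + 2 - 1 = m + 1 by omega, Nat.add_sub_cancel]
    simp only [ContractivePoly.ratio_eq]
    simp at h
    push_cast
    linarith
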